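/- Let $n\ge 0$ and let $P\subset\mathbb R^n$ be a parallelotope centred at the origin, i.e. a convex polytope with nonempty interior and $-P=P$ whose translates $t+P$, $t\in\mathcal T$, by a group $\mathcal T$ of translation vectors cover $\mathbb R^n$, have pairwise disjoint interiors, and pairwise meet in the empty set or in a common face. Let $\pm F_i$, $i\in\mathcal I$, be the pairs of opposite facets of $P$, each pair listed exactly once. For $i\in\mathcal I$ let $t_i\in\mathcal T$ be the vector with $P\cap(t_i+P)=F_i$, and let $q_i$ be a facet vector (outer normal vector) of $F_i$, i.e. $x\mapsto q_i^Tx$ attains its maximum over $P$ exactly on $F_i$. The belt of an $(n-2)$-face $G$ of $P$ is the set of facets of $P$ that are parallel to $G$, i.e. that project along $G$ onto edges of a polygon. A set $\{i,j,k\}$ of three distinct indices is a 3-belt if $\pm F_i,\pm F_j,\pm F_k$ are exactly the facets of a belt; a set $\{i,j\}$ of two distinct indices is a 2-belt if $\pm F_i,\pm F_j$ are exactly the facets of a belt. Vectors $p_i,p_j,p_k$ are canonical with respect to a 3-belt $\{i,j,k\}$ if there are signs $\varepsilon,\delta\in\{\pm1\}$ with $t_i=\varepsilon t_j+\delta t_k$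 and $p_i=\varepsilon p_j+\delta p_k$. Fix $i\in\mathcal I$, and let $\mathcal I_i$ be the set of $j\in\mathcal I$ such that $F_i\cap F_j$ or $F_i\cap(-F_j)$ is an $(n-2)$-face of $P$. Then the facet vectors $q_j$, $j\in\mathcal I_i$, can be multiplied by positive numbers so that, with $q_i$ (and all other facet vectors) unchanged, the resulting vectors are canonical with respect to every 3-belt containing $i$. Moreover, let $p_j$, $j\in\mathcal I$, be any nonzero multiples of the $q_j$ that are canonical with respect to every 3-belt containing $i$. Then: 1) for each 3-belt $\{i,j,k\}$ containing $i$: $p_i^Tt_j=p_j^Tt_i$, $p_i^Tt_k=p_k^Tt_i$ and $p_j^Tt_k=p_k^Tt_j$; 2) for each 2-belt $\{i,j\}$ containing $i$: $p_j^Tt_i=p_i^Tt_j=0$. -/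

import Mathlib

open scoped Pointwise

/-- `F` is a nonempty face of `P` of codimension `c` in `ℝⁿ`, i.e. an `(n - c)`-face of `P`. -/
def IsFaceOfCodim {n : ℕ} (c : ℕ) (P F : Set (EuclideanSpace ℝ (Fin n))) : Prop :=
  F.Nonempty ∧ IsExposed ℝ P F ∧ Module.finrank ℝ (vectorSpan ℝ F) + c = n

/-- Facets are the `(n - 1)`-faces. -/
def IsPolytopeFacet {n : ℕ} (P F : Set (EuclideanSpace ℝ (Fin n))) : Prop :=
  IsFaceOfCodim 1 P F

/-- `P` is a parallelotope with translation group `T`: a convex polytope with nonempty interior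
whose translates `t + P`, `t ∈ T`, form a face-to-face tiling of `ℝⁿ`. As `T` is a group, it is
enough to compare each translate with `P` itself. -/
structure IsParallelotope {n : ℕ} (P : Set (EuclideanSpace ℝ (Fin n)))
    (T : AddSubgroup (EuclideanSpace ℝ (Fin n))) : Prop where
  polytope : ∃ s : Finset (EuclideanSpace ℝ (Fin n)),
    P = convexHull ℝ (s : Set (EuclideanSpace ℝ (Fin n)))
  interior_nonempty : (interior P).Nonempty
  covering : ∀ x : EuclideanSpace ℝ (Fin n), ∃ t ∈ T, x ∈ t +ᵥ P
  packing : ∀ t ∈ T, t ≠ 0 → Disjoint (interior P) (interior (t +ᵥ P))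
  face_to_face : ∀ t ∈ T,
    IsExposed ℝ P (P ∩ (t +ᵥ P)) ∧ IsExposed ℝ (t +ᵥ P) (P ∩ (t +ᵥ P))

/-- The index type `ι` enumerates the pairs of opposite facets `± F i` of the parallelotope `P`
(centred at the origin), and `t i ∈ T` is the lattice vector for which `t i + P` is the tile
adjacent to `P` along the facet `F i`. -/
structure IsFacetSystem {n : ℕ} {ι : Type*} (P : Set (EuclideanSpace ℝ (Fin n)))
    (T : AddSubgroup (EuclideanSpace ℝ (Fin n)))
    (F : ι → Set (EuclideanSpace ℝ (Fin n))) (t : ι → EuclideanSpace ℝ (Fin n)) : Prop where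
  facet : ∀ i, IsPolytopeFacet P (F i)
  enumerates : ∀ H, IsPolytopeFacet P H → ∃! i, H = F i ∨ H = -F i
  mem_lattice : ∀ i, t i ∈ T
  adjacent : ∀ i, P ∩ (t i +ᵥ P) = F i

/-- `q` is a facet vector (outer normal vector) of the facet `F` of `P`: the linear form `qᵀx`
attains its maximum over `P` exactly on `F`. -/
def IsFacetVector {n : ℕ} (P F : Set (EuclideanSpace ℝ (Fin n)))
    (q : EuclideanSpace ℝ (Fin n)) : Prop :=
  F = {x | x ∈ P ∧ ∀ y ∈ P, inner ℝ q y ≤ inner ℝ q x}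

/-- The belt of `P` determined by an `(n - 2)`-face `G`: the set of facets of `P` parallel to `G`,
that is, the facets which the projection along `G` maps onto edges of the
projected polygon. -/
def facetBelt {n : ℕ} (P G : Set (EuclideanSpace ℝ (Fin n))) :
    Set (Set (EuclideanSpace ℝ (Fin n))) :=
  {H | IsPolytopeFacet P H ∧ vectorSpan ℝ G ≤ vectorSpan ℝ H}

/-- `{i, j, k}` is a 3-belt: the six facets `± F i`, `± F j`, `± F k` form a belt. -/
def IsThreeBelt {n : ℕ} {ι : Type*} (P : Set (EuclideanSpace ℝ (Fin n)))
    (F : ι → Set (EuclideanSpace ℝ (Fin n))) (i j k : ι) : Prop :=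
  i ≠ j ∧ i ≠ k ∧ j ≠ k ∧
    ∃ G, IsFaceOfCodim 2 P G ∧ facetBelt P G = {F i, -F i, F j, -F j, F k, -F k}

/-- `{i, j}` is a 2-belt: the four facets `± F i`, `± F j` form a belt. -/
def IsTwoBelt {n : ℕ} {ι : Type*} (P : Set (EuclideanSpace ℝ (Fin n)))
    (F : ι → Set (EuclideanSpace ℝ (Fin n))) (i j : ι) : Prop :=
  i ≠ j ∧ ∃ G, IsFaceOfCodim 2 P G ∧ facetBelt P G = {F i, -F i, F j, -F j}

/-- The indices `j` such that `F j` or `-F j` meets `F i` in an `(n - 2)`-face of `P`. -/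
def adjacentIndices {n : ℕ} {ι : Type*} (P : Set (EuclideanSpace ℝ (Fin n)))
    (F : ι → Set (EuclideanSpace ℝ (Fin n))) (i : ι) : Set ι :=
  {j | IsFaceOfCodim 2 P (F i ∩ F j) ∨ IsFaceOfCodim 2 P (F i ∩ -F j)}

/-- The vectors `q i, q j, q k` are canonical with respect to the lattice vectors
`t i, t j, t k`: both triples satisfy one and the same relation `u i = ε u j + δ u k` with signs
`ε, δ ∈ {1, -1}`. -/
def IsCanonicalTriple {n : ℕ} {ι : Type*} (t q : ι → EuclideanSpace ℝ (Fin n))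
    (i j k : ι) : Prop :=
  ∃ ε δ : ℝ, (ε = 1 ∨ ε = -1) ∧ (δ = 1 ∨ δ = -1) ∧
    t i = ε • t j + δ • t k ∧ q i = ε • q j + δ • q k

/-- The vectors `q` are canonical with respect to all 3-belts containing the facet `F i`. -/
def IsCanonicalAt {n : ℕ} {ι : Type*} (P : Set (EuclideanSpace ℝ (Fin n)))
    (F : ι → Set (EuclideanSpace ℝ (Fin n))) (t q : ι → EuclideanSpace ℝ (Fin n))
    (i : ι) : Prop :=
  ∀ j k, IsThreeBelt P F i j k → IsCanonicalTriple t q i j k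

/-! Projected along its direction, a belt becomes a centrally symmetric polygon, and the theorem is
a statement about this polygon. Since `x ↦ t i - x` exchanges `P` and `t i + P`, each facet `F i` is
symmetric about `t i / 2`. This reflection swaps the two codimension two faces in which a facet
meets its neighbours in the belt. Faces are treated as sets of maximizers of linear forms, and
"parallel to the belt" becomes membership of the normal in the plane orthogonal to `G`.

A belt of six facets is a hexagon `A, B, C, -A, -B, -C` (`exists_hexagon`). From a point `x` of `A ∩
B`, reflection in `A` gives `y` in `A ∩ -C`, and reflection in `B` gives `z` in `B ∩ C`. The hexagon
closes up because the composite of the successive reflections translates a bounded set into itself.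
Hence, for suitable signs, `t i = x + y`, `t j = x + z` and `t k = y - z`, so `t i = t j + t k`; the
normal of `A` is a positive combination of those of `B` and `-C` (`hexagon_relations`).

The coefficients in this combination are the required scalings. They are consistent because `i` and
`j` determine the 3-belt (`threeBelt_unique`). The symmetry relations then follow linearly from the
normals being constant along their facets. In a 2-belt the two neighbours of `F i` are `±F j`, so
reflection shows that `t i` is parallel to `F j`. -/

/-- The face of `P` on which the linear form `⟪u, ·⟫` attains its maximum. -/
def maxFace {n : ℕ} (P : Set (EuclideanSpace ℝ (Fin n))) (u : EuclideanSpace ℝ (Fin n)) :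
    Set (EuclideanSpace ℝ (Fin n)) :=
  {x | x ∈ P ∧ ∀ y ∈ P, inner ℝ u y ≤ inner ℝ u x}

/-! ### Faces of polytopes as maximizers of linear forms. -/

section Faces

variable {n : ℕ} {P A B G : Set (EuclideanSpace ℝ (Fin n))}
  {s : Finset (EuclideanSpace ℝ (Fin n))} {u v w x y : EuclideanSpace ℝ (Fin n)}

theorem isExposed_maxFace : IsExposed ℝ P (maxFace P u) := fun _ =>
  ⟨innerSL ℝ u, by simp [maxFace]⟩

theorem exists_eq_maxFace (hG : IsExposed ℝ P G) (hne : G.Nonempty) : ∃ u, G = maxFace P u := by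
  obtain ⟨l, rfl⟩ := hG hne
  refine ⟨(InnerProductSpace.toDual ℝ _).symm l, ?_⟩
  simp [maxFace]

theorem inner_eq_of_mem_maxFace (hx : x ∈ maxFace P u) (hy : y ∈ maxFace P u) :
    inner ℝ u x = inner ℝ u y :=
  le_antisymm (hy.2 x hx.1) (hx.2 y hy.1)

theorem mem_maxFace_of_inner_eq (hx : x ∈ maxFace P u) (hy : y ∈ P)
    (h : inner ℝ u y = inner ℝ u x) : y ∈ maxFace P u :=
  ⟨hy, fun z hz => h ▸ hx.2 z hz⟩

theorem inner_lt_of_notMem_maxFace (hx : x ∈ maxFace P u) (hy : y ∈ P) (h : y ∉ maxFace P u) :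
    inner ℝ u y < inner ℝ u x :=
  lt_of_le_of_ne (hx.2 y hy) fun e => h (mem_maxFace_of_inner_eq hx hy e)

theorem mem_orthogonal_vectorSpan (h : ∀ x ∈ G, ∀ y ∈ G, inner ℝ u x = inner ℝ u y) :
    u ∈ (vectorSpan ℝ G)ᗮ := by
  have : vectorSpan ℝ G ≤ (ℝ ∙ u)ᗮ := by
    rw [vectorSpan_def, Submodule.span_le]
    rintro _ ⟨x, hx, y, hy, rfl⟩
    rw [SetLike.mem_coe, Submodule.mem_orthogonal_singleton_iff_inner_right]
    simp [inner_sub_right, h x hx y hy]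
  rw [Submodule.mem_orthogonal]
  intro z hz
  rw [real_inner_comm]
  exact Submodule.mem_orthogonal_singleton_iff_inner_right.1 (this hz)

theorem mem_orthogonal_of_subset (h : G ⊆ maxFace P u) : u ∈ (vectorSpan ℝ G)ᗮ :=
  mem_orthogonal_vectorSpan fun _ hx _ hy => inner_eq_of_mem_maxFace (h hx) (h hy)

theorem inner_eq_of_mem_orthogonal (hu : u ∈ (vectorSpan ℝ G)ᗮ) (hx : x ∈ G) (hy : y ∈ G) :
    inner ℝ u x = inner ℝ u y := by
  have := (Submodule.mem_orthogonal' _ _).1 hu _ (vsub_mem_vectorSpan ℝ hx hy)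
  rw [vsub_eq_sub, inner_sub_right] at this
  linarith

theorem vectorSpan_eq_top_of_interior (hP : (interior P).Nonempty) : vectorSpan ℝ P = ⊤ := by
  have h : affineSpan ℝ (interior P) = ⊤ := isOpen_interior.affineSpan_eq_top hP
  have h2 : affineSpan ℝ P = ⊤ := top_le_iff.1 (h ▸ affineSpan_mono ℝ interior_subset)
  rw [← direction_affineSpan, h2, AffineSubspace.direction_top]

theorem eq_zero_of_inner_const (hP : (interior P).Nonempty)
    (h : ∀ x ∈ P, ∀ y ∈ P, inner ℝ u x = inner ℝ u y) : u = 0 := by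
  have := mem_orthogonal_vectorSpan h
  rw [vectorSpan_eq_top_of_interior hP] at this
  simpa using this

theorem ne_zero_of_codim {c : ℕ} (hP : (interior P).Nonempty) (hc : c ≠ 0)
    (h : IsFaceOfCodim c P (maxFace P u)) : u ≠ 0 := by
  rintro rfl
  have e : maxFace P 0 = P := by simp [maxFace]
  have := h.2.2
  rw [e, vectorSpan_eq_top_of_interior hP, finrank_top, finrank_euclideanSpace_fin] at this
  omega

theorem finrank_orthogonal_of_codim {c : ℕ} (h : IsFaceOfCodim c P G) :
    Module.finrank ℝ (vectorSpan ℝ G)ᗮ = c := by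
  have h1 := Submodule.finrank_add_finrank_orthogonal (vectorSpan ℝ G)
  rw [finrank_euclideanSpace_fin] at h1
  have := h.2.2
  omega

theorem vectorSpan_facet (hP : (interior P).Nonempty) (h : IsPolytopeFacet P (maxFace P u)) :
    vectorSpan ℝ (maxFace P u) = (ℝ ∙ u)ᗮ := by
  have hu := ne_zero_of_codim hP one_ne_zero h
  have h1 : (ℝ ∙ u) ≤ (vectorSpan ℝ (maxFace P u))ᗮ := by
    rw [Submodule.span_singleton_le_iff_mem]
    exact mem_orthogonal_of_subset subset_rfl
  have h2 := Submodule.eq_of_le_of_finrank_eq h1 (by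
    rw [finrank_span_singleton hu, finrank_orthogonal_of_codim h])
  rw [h2, Submodule.orthogonal_orthogonal]

/-- Turns membership in a belt into a linear condition on the normal. -/
theorem le_vectorSpan_facet_iff (hP : (interior P).Nonempty)
    (h : IsPolytopeFacet P (maxFace P u)) {L : Submodule ℝ (EuclideanSpace ℝ (Fin n))} :
    L ≤ vectorSpan ℝ (maxFace P u) ↔ u ∈ Lᗮ := by
  rw [vectorSpan_facet hP h, Submodule.le_orthogonal_iff_le_orthogonal,
    Submodule.span_singleton_le_iff_mem]

theorem maxFace_smul {c : ℝ} (hc : 0 < c) : maxFace P (c • u) = maxFace P u := by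
  ext x
  simp [maxFace, inner_smul_left, hc]

/-- Normals with a positive ratio have the same maximizers. With a negative ratio, a common point
would both maximize and minimize `u`, making `u` constant on `P`. -/
theorem pair_independent_of_facets (hP : (interior P).Nonempty)
    (hu : IsPolytopeFacet P (maxFace P u)) (hv : IsPolytopeFacet P (maxFace P v))
    (hne : maxFace P u ≠ maxFace P v) (hx : x ∈ maxFace P u) (hx' : x ∈ maxFace P v) :
    LinearIndependent ℝ ![u, v] := by
  have hu0 := ne_zero_of_codim hP one_ne_zero hu
  have hv0 := ne_zero_of_codim hP one_ne_zero hv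
  rw [LinearIndependent.pair_iff' hu0]
  intro a ha
  rcases lt_trichotomy a 0 with h | h | h
  · apply hu0
    have key : ∀ y ∈ P, inner ℝ u y = inner ℝ u x := by
      intro y hy
      have h1 := hx.2 y hy
      have h2 := hx'.2 y hy
      rw [← ha, inner_smul_left, inner_smul_left] at h2
      simp only [conj_trivial] at h2
      nlinarith
    exact eq_zero_of_inner_const hP fun y hy z hz => (key y hy).trans (key z hz).symm
  · subst h
    exact hv0 (by simpa using ha.symm)
  · apply hne
    rw [← ha, maxFace_smul h]

theorem exists_pair_combination {L : Submodule ℝ (EuclideanSpace ℝ (Fin n))}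
    (hL : Module.finrank ℝ L = 2) (h : LinearIndependent ℝ ![u, v]) (hu : u ∈ L) (hv : v ∈ L)
    (hw : w ∈ L) : ∃ a b : ℝ, w = a • u + b • v := by
  have hle : Submodule.span ℝ {u, v} ≤ L := by
    rw [Submodule.span_le]
    rintro z (rfl | rfl) <;> assumption
  have hfr : Module.finrank ℝ (Submodule.span ℝ {u, v}) = 2 := by
    have := finrank_span_eq_card h
    rw [Matrix.range_cons, Matrix.range_cons, Matrix.range_empty, Set.union_empty,
      Set.singleton_union] at this
    simpa using this
  have := Submodule.eq_of_le_of_finrank_eq hle (by rw [hfr, hL])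
  rw [← this, Submodule.mem_span_pair] at hw
  obtain ⟨a, b, h⟩ := hw
  exact ⟨a, b, h.symm⟩

theorem eq_of_facet_subset (hP : (interior P).Nonempty)
    (hu : IsPolytopeFacet P (maxFace P u)) (hv : IsPolytopeFacet P (maxFace P v))
    (h : maxFace P u ⊆ maxFace P v) : maxFace P u = maxFace P v := by
  by_contra hne
  obtain ⟨x, hx⟩ := hu.1
  have hli := pair_independent_of_facets hP hu hv hne hx (h hx)
  have hv' : v ∈ (vectorSpan ℝ (maxFace P u))ᗮ := mem_orthogonal_of_subset h
  rw [vectorSpan_facet hP hu, Submodule.orthogonal_orthogonal,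
    Submodule.mem_span_singleton] at hv'
  obtain ⟨a, ha⟩ := hv'
  exact (LinearIndependent.pair_iff' (ne_zero_of_codim hP one_ne_zero hu)).1 hli a ha

/-- The orthogonal complement of the direction of `G` is a plane, so two independent facet normals
span it. -/
theorem exists_combination_of_facets (hP : (interior P).Nonempty) (hG : IsFaceOfCodim 2 P G)
    (hu : IsPolytopeFacet P (maxFace P u)) (hv : IsPolytopeFacet P (maxFace P v))
    (hne : maxFace P u ≠ maxFace P v) (hGu : G ⊆ maxFace P u) (hGv : G ⊆ maxFace P v)
    (hw : w ∈ (vectorSpan ℝ G)ᗮ) : ∃ a b : ℝ, w = a • u + b • v := by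
  obtain ⟨x, hx⟩ := hG.1
  exact exists_pair_combination (finrank_orthogonal_of_codim hG)
    (pair_independent_of_facets hP hu hv hne (hGu hx) (hGv hx))
    (mem_orthogonal_of_subset hGu) (mem_orthogonal_of_subset hGv) hw

theorem inter_eq_of_subset (hP : (interior P).Nonempty) (hG : IsFaceOfCodim 2 P G)
    (hu : IsPolytopeFacet P (maxFace P u)) (hv : IsPolytopeFacet P (maxFace P v))
    (hne : maxFace P u ≠ maxFace P v) (hGu : G ⊆ maxFace P u) (hGv : G ⊆ maxFace P v) :
    maxFace P u ∩ maxFace P v = G := by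
  refine Set.Subset.antisymm ?_ (Set.subset_inter hGu hGv)
  obtain ⟨x, hx⟩ := hG.1
  obtain ⟨f, rfl⟩ := exists_eq_maxFace hG.2.1 hG.1
  obtain ⟨a, b, hf⟩ := exists_combination_of_facets hP hG hu hv hne hGu hGv
    (mem_orthogonal_of_subset subset_rfl)
  rintro y ⟨hy, hy'⟩
  refine mem_maxFace_of_inner_eq hx hy.1 ?_
  rw [hf]
  simp only [inner_add_left, inner_smul_left, inner_eq_of_mem_maxFace hy (hGu hx),
    inner_eq_of_mem_maxFace hy' (hGv hx)]

/-- A codimension two face lies in at most two facets. -/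
theorem facet_eq_or_eq (hP : (interior P).Nonempty) (hG : IsFaceOfCodim 2 P G)
    (hu : IsPolytopeFacet P (maxFace P u)) (hv : IsPolytopeFacet P (maxFace P v))
    (hw : IsPolytopeFacet P (maxFace P w))
    (hne : maxFace P u ≠ maxFace P v) (hGu : G ⊆ maxFace P u) (hGv : G ⊆ maxFace P v)
    (hGw : G ⊆ maxFace P w) : maxFace P w = maxFace P u ∨ maxFace P w = maxFace P v := by
  obtain ⟨g, hg⟩ := hG.1
  obtain ⟨a, b, hf⟩ := exists_combination_of_facets hP hG hu hv hne hGu hGv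
    (mem_orthogonal_of_subset hGw)
  obtain ⟨z₁, hz₁, hz₁'⟩ : ∃ z ∈ maxFace P u, z ∉ maxFace P v := by
    by_contra! h
    exact hne (eq_of_facet_subset hP hu hv h)
  obtain ⟨z₂, hz₂, hz₂'⟩ : ∃ z ∈ maxFace P v, z ∉ maxFace P u := by
    by_contra! h
    exact hne (eq_of_facet_subset hP hv hu h).symm
  have hin : ∀ z, inner ℝ w z = a * inner ℝ u z + b * inner ℝ v z := by
    intro z
    rw [hf]
    simp [inner_add_left, inner_smul_left]
  -- Moving from `g` to `z₁` keeps `u` constant and lowers `v`; since `g` maximizes `w`, the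
  -- coefficient of `v` cannot be negative.
  have hb : 0 ≤ b := by
    have h1 := (hGw hg).2 z₁ hz₁.1
    have h2 := inner_eq_of_mem_maxFace hz₁ (hGu hg)
    have h3 := inner_lt_of_notMem_maxFace (hGv hg) hz₁.1 hz₁'
    rw [hin, hin, h2] at h1
    by_contra! hb
    nlinarith
  have ha : 0 ≤ a := by
    have h1 := (hGw hg).2 z₂ hz₂.1
    have h2 := inner_eq_of_mem_maxFace hz₂ (hGv hg)
    have h3 := inner_lt_of_notMem_maxFace (hGu hg) hz₂.1 hz₂'
    rw [hin, hin, h2] at h1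
    by_contra! hb
    nlinarith
  rcases ha.eq_or_lt with rfl | ha
  · right
    rcases hb.eq_or_lt with rfl | hb
    · exact absurd (by simpa using hf) (ne_zero_of_codim hP one_ne_zero hw)
    · rw [hf, zero_smul, zero_add, maxFace_smul hb]
  · left
    refine eq_of_facet_subset hP hw hu fun y hy => mem_maxFace_of_inner_eq (hGu hg) hy.1 ?_
    have h1 := inner_eq_of_mem_maxFace hy (hGw hg)
    have h2 := (hGu hg).2 y hy.1
    have h3 := (hGv hg).2 y hy.1
    rw [hin, hin] at h1
    refine le_antisymm h2 ?_
    by_contra! h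
    nlinarith

theorem inner_le_of_convexHull (hs : P = convexHull ℝ (s : Set _)) {c : ℝ}
    (h : ∀ x ∈ s, inner ℝ u x ≤ c) (hx : x ∈ P) : inner ℝ u x ≤ c := by
  have : convexHull ℝ (s : Set _) ⊆ {y | inner ℝ u y ≤ c} :=
    convexHull_min h (convex_halfSpace_le (innerSL ℝ u).toLinearMap.isLinear c)
  exact this (hs ▸ hx)

theorem subset_of_convexHull (hs : P = convexHull ℝ (s : Set _)) (hx : x ∈ s) : x ∈ P :=
  hs ▸ subset_convexHull ℝ _ hx

/-- Every nonempty face of a polytope contains one of the spanning points. -/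
theorem exists_mem_maxFace (hs : P = convexHull ℝ (s : Set _)) (hx : x ∈ maxFace P u) :
    ∃ y ∈ s, y ∈ maxFace P u := by
  have hne : s.Nonempty := by
    rw [← Finset.coe_nonempty, ← convexHull_nonempty_iff (𝕜 := ℝ), ← hs]
    exact ⟨x, hx.1⟩
  obtain ⟨y, hy, hmax⟩ := s.exists_max_image (fun z => inner ℝ u z) hne
  exact ⟨y, hy, subset_of_convexHull hs hy, fun z hz => inner_le_of_convexHull hs hmax hz⟩

/-- Faces of faces of a polytope are faces. -/
theorem maxFace_maxFace (hs : P = convexHull ℝ (s : Set _))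
    (hne : (maxFace (maxFace P u) w).Nonempty) :
    ∃ v, maxFace P v = maxFace (maxFace P u) w := by
  obtain ⟨g, hg⟩ := hne
  -- For a large weight `N` on `u`, every vertex off the `u`-face loses more than `w` can gain back.
  -- The form finally used has weight `N + 1`; the spare unit forces its maximizers onto the
  -- `u`-face.
  have hev : ∀ᶠ N : ℝ in Filter.atTop, ∀ x ∈ s,
      N * inner ℝ u x + inner ℝ w x ≤ N * inner ℝ u g + inner ℝ w g := by
    rw [Filter.eventually_all_finset]
    intro x hx
    have hxP := subset_of_convexHull hs hx
    by_cases hxu : x ∈ maxFace P u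
    · refine Filter.Eventually.of_forall fun N => ?_
      rw [inner_eq_of_mem_maxFace hxu hg.1]
      have := hg.2 x hxu
      linarith
    · have hlt := inner_lt_of_notMem_maxFace hg.1 hxP hxu
      filter_upwards [Filter.eventually_ge_atTop
        ((inner ℝ w x - inner ℝ w g) / (inner ℝ u g - inner ℝ u x))] with N hN
      rw [div_le_iff₀ (by linarith)] at hN
      linarith
  obtain ⟨N, hN⟩ := Filter.eventually_atTop.1 hev
  have hle : ∀ M ≥ N, ∀ y ∈ P, M * inner ℝ u y + inner ℝ w y ≤ M * inner ℝ u g + inner ℝ w g := by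
    intro M hM y hy
    have := inner_le_of_convexHull (u := M • u + w) (c := M * inner ℝ u g + inner ℝ w g) hs
      (by simpa [inner_add_left, inner_smul_left] using hN M hM) hy
    simpa [inner_add_left, inner_smul_left] using this
  have hin : ∀ z, inner ℝ ((N + 1) • u + w) z = (N + 1) * inner ℝ u z + inner ℝ w z := by
    intro z
    simp [inner_add_left, inner_smul_left]
  have hgm : g ∈ maxFace P ((N + 1) • u + w) := by
    refine ⟨hg.1.1, fun y hy => ?_⟩
    rw [hin, hin]
    exact hle _ (by linarith) y hy
  refine ⟨(N + 1) • u + w, Set.Subset.antisymm ?_ ?_⟩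
  · intro y hy
    have h1 := inner_eq_of_mem_maxFace hy hgm
    rw [hin, hin] at h1
    have h2 := hle N le_rfl y hy.1
    have h3 := hg.1.2 y hy.1
    have h4 : inner ℝ u y = inner ℝ u g := by linarith
    refine mem_maxFace_of_inner_eq hg (mem_maxFace_of_inner_eq hg.1 hy.1 h4) ?_
    rw [h4] at h1
    linarith
  · intro y hy
    refine mem_maxFace_of_inner_eq hgm hy.1.1 ?_
    rw [hin, hin, inner_eq_of_mem_maxFace hy.1 hg.1, inner_eq_of_mem_maxFace hy hg]

/-- Tilting a supporting hyperplane of a face `maxFace P f` in a direction `g` until it touches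
a further vertex. -/
theorem exists_tilt (hs : P = convexHull ℝ (s : Set _)) {f g z : EuclideanSpace ℝ (Fin n)}
    (hz : z ∈ maxFace P f) (hg : g ∈ (vectorSpan ℝ (maxFace P f))ᗮ)
    (hne : ∃ y ∈ P, y ∉ maxFace P f) :
    ∃ r : ℝ, ∃ y ∈ P, y ∉ maxFace P f ∧ y ∈ maxFace P (g + r • f) ∧
      maxFace P f ⊆ maxFace P (g + r • f) := by
  classical
  have hin : ∀ r z, inner ℝ (g + r • f) z = inner ℝ g z + r * inner ℝ f z := by
    intro r z
    simp [inner_add_left, inner_smul_left]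
  have hne' : (s.filter fun y => y ∉ maxFace P f).Nonempty := by
    by_contra h
    rw [Finset.not_nonempty_iff_eq_empty, Finset.filter_eq_empty_iff] at h
    push Not at h
    obtain ⟨y, hy, hy'⟩ := hne
    refine hy' (mem_maxFace_of_inner_eq hz hy (le_antisymm (hz.2 y hy) ?_))
    have := inner_le_of_convexHull (u := -f) (c := -inner ℝ f z) hs (fun x hx => by
      rw [inner_neg_left, inner_eq_of_mem_maxFace (h hx) hz]) hy
    rw [inner_neg_left] at this
    linarith
  -- The maximal ratio is the least `r` for which `g + r • f` still attains its maximum on the face;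
  -- the vertex `y` realizing it is the one newly touched.
  obtain ⟨y, hy, hmax⟩ := Finset.exists_max_image _
    (fun y => (inner ℝ g y - inner ℝ g z) / (inner ℝ f z - inner ℝ f y)) hne'
  rw [Finset.mem_filter] at hy
  have hyP := subset_of_convexHull hs hy.1
  set r := (inner ℝ g y - inner ℝ g z) / (inner ℝ f z - inner ℝ f y) with hr
  have hzm : z ∈ maxFace P (g + r • f) := by
    refine ⟨hz.1, fun p hp => inner_le_of_convexHull hs (fun x hx => ?_) hp⟩
    rw [hin, hin]
    by_cases hxf : x ∈ maxFace P f
    · rw [inner_eq_of_mem_maxFace hxf hz, inner_eq_of_mem_orthogonal hg hxf hz]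
    · have h1 := hmax x (Finset.mem_filter.2 ⟨hx, hxf⟩)
      have hlt := inner_lt_of_notMem_maxFace hz (subset_of_convexHull hs hx) hxf
      rw [div_le_iff₀ (by linarith)] at h1
      linarith
  refine ⟨r, y, hyP, hy.2, mem_maxFace_of_inner_eq hzm hyP ?_, fun x hx =>
    mem_maxFace_of_inner_eq hzm hx.1 ?_⟩
  · rw [hin, hin]
    have hlt := inner_lt_of_notMem_maxFace hz hyP hy.2
    have : r * (inner ℝ f z - inner ℝ f y) = inner ℝ g y - inner ℝ g z := by
      rw [hr, div_mul_cancel₀]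
      linarith
    linarith
  · rw [hin, hin, inner_eq_of_mem_maxFace hx hz, inner_eq_of_mem_orthogonal hg hx hz]

/-- The point `y` raises the dimension above `n - 2`, and `u ≠ 0` caps it at `n - 1`. -/
theorem isFacet_of_codim_two_subset (hG : IsFaceOfCodim 2 P G)
    (hu : u ≠ 0) (hGu : G ⊆ maxFace P u) (hy : y ∈ maxFace P u) (hyG : y ∉ G) :
    IsPolytopeFacet P (maxFace P u) := by
  obtain ⟨g, hg⟩ := hG.1
  refine ⟨⟨y, hy⟩, isExposed_maxFace, ?_⟩
  have h1 : vectorSpan ℝ G < vectorSpan ℝ (maxFace P u) := by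
    refine lt_of_le_of_ne (vectorSpan_mono ℝ hGu) fun h => hyG ?_
    obtain ⟨f, rfl⟩ := exists_eq_maxFace hG.2.1 hG.1
    refine mem_maxFace_of_inner_eq hg hy.1 ?_
    have hf : f ∈ (vectorSpan ℝ (maxFace P u))ᗮ := by
      rw [← h]
      exact mem_orthogonal_of_subset subset_rfl
    exact inner_eq_of_mem_orthogonal hf hy (hGu hg)
  have h2 := Submodule.finrank_lt_finrank_of_lt h1
  have h3 : (ℝ ∙ u) ≤ (vectorSpan ℝ (maxFace P u))ᗮ := by
    rw [Submodule.span_singleton_le_iff_mem]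
    exact mem_orthogonal_of_subset subset_rfl
  have h4 := Submodule.finrank_mono h3
  rw [finrank_span_singleton hu] at h4
  have h5 := Submodule.finrank_add_finrank_orthogonal (vectorSpan ℝ (maxFace P u))
  rw [finrank_euclideanSpace_fin] at h5
  have := hG.2.2
  omega

/-- A codimension two face lies in two distinct facets. -/
theorem exists_two_facets (hs : P = convexHull ℝ (s : Set _)) (hP : (interior P).Nonempty)
    (hG : IsFaceOfCodim 2 P G) :
    ∃ u v, IsPolytopeFacet P (maxFace P u) ∧ IsPolytopeFacet P (maxFace P v) ∧
      maxFace P u ≠ maxFace P v ∧ G ⊆ maxFace P u ∧ G ⊆ maxFace P v := by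
  have hG' := hG
  obtain ⟨f, rfl⟩ := exists_eq_maxFace hG.2.1 hG.1
  obtain ⟨z, hz⟩ := hG.1
  have hf0 : f ≠ 0 := ne_zero_of_codim hP two_ne_zero hG
  have hfL : f ∈ (vectorSpan ℝ (maxFace P f))ᗮ := mem_orthogonal_of_subset subset_rfl
  -- The two facets arise by tilting in the directions `g` and `-g`; independence from `f` keeps all
  -- tilted forms nonzero.
  obtain ⟨g, hg, hgf⟩ : ∃ g ∈ (vectorSpan ℝ (maxFace P f))ᗮ, g ∉ (ℝ ∙ f) := by
    by_contra! h
    have := Submodule.finrank_mono (show _ ≤ (ℝ ∙ f) from h)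
    rw [finrank_orthogonal_of_codim hG, finrank_span_singleton hf0] at this
    omega
  have hne : ∃ y ∈ P, y ∉ maxFace P f := by
    by_contra! h
    exact hf0 (eq_zero_of_inner_const hP fun x hx y hy =>
      inner_eq_of_mem_maxFace (h x hx) (h y hy))
  have hnz : ∀ r : ℝ, g + r • f ≠ 0 := fun r h => hgf (by
    rw [Submodule.mem_span_singleton]
    exact ⟨-r, by rw [neg_smul, eq_comm]; exact eq_neg_of_add_eq_zero_left h⟩)
  have hnz' : ∀ r : ℝ, -g + r • f ≠ 0 := fun r h => hnz (-r) (by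
    rw [neg_smul, ← neg_eq_zero, neg_add, neg_neg]
    exact h)
  obtain ⟨r, y, hyP, hy, hyr, hr⟩ := exists_tilt hs hz hg hne
  obtain ⟨r', y', hyP', hy', hyr', hr'⟩ := exists_tilt hs hz (Submodule.neg_mem _ hg) hne
  have hu := isFacet_of_codim_two_subset hG (hnz r) hr hyr hy
  have hv := isFacet_of_codim_two_subset hG (hnz' r') hr' hyr' hy'
  refine ⟨_, _, hu, hv, fun h => ?_, hr, hr'⟩
  -- The two tilted forms add up to `(r + r') • f`. If they defined the same facet, comparing `y`
  -- with `z` would give `r + r' = 0`; the forms would be opposite, hence constant on `P`.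
  have hsum : ∀ x, inner ℝ (g + r • f) x + inner ℝ (-g + r' • f) x = (r + r') * inner ℝ f x := by
    intro x
    simp only [inner_add_left, inner_smul_left, inner_neg_left, conj_trivial]
    ring
  have h1 : inner ℝ f y < inner ℝ f z := inner_lt_of_notMem_maxFace hz hyP hy
  have h2 := inner_eq_of_mem_maxFace hyr (hr hz)
  have h3 := inner_eq_of_mem_maxFace (h ▸ hyr) (hr' hz)
  have h4 : (r + r') * (inner ℝ f z - inner ℝ f y) = 0 := by
    have := hsum y
    have := hsum z
    linarith
  have h5 : r + r' = 0 := by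
    rcases mul_eq_zero.1 h4 with h | h
    · exact h
    · linarith
  refine hnz r (eq_zero_of_inner_const hP ?_)
  have key : ∀ x ∈ P, inner ℝ (g + r • f) x = inner ℝ (g + r • f) z := by
    intro x hx
    refine le_antisymm ((hr hz).2 x hx) ?_
    have e1 := (hr' hz).2 x hx
    have e2 := hsum x
    have e3 := hsum z
    rw [h5, zero_mul] at e2 e3
    linarith
  exact fun x hx x' hx' => (key x hx).trans (key x' hx').symm

end Faces

/-! ### Belts and the neighbours of a facet in its belt. -/

section Belts

variable {n : ℕ} {P A B G : Set (EuclideanSpace ℝ (Fin n))}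
  {s : Finset (EuclideanSpace ℝ (Fin n))} {u v w x y t : EuclideanSpace ℝ (Fin n)}
  {L : Submodule ℝ (EuclideanSpace ℝ (Fin n))}

theorem vectorSpan_image_sub_left : vectorSpan ℝ ((fun x => t - x) '' G) = vectorSpan ℝ G := by
  have h := AffineMap.map_vectorSpan
    (AffineEquiv.constVSub ℝ t).toAffineMap (s := G)
  have e : ((AffineEquiv.constVSub ℝ t).toAffineMap : _ → _) '' G = (fun x => t - x) '' G := by
    simp
  rw [e] at h
  rw [← h]
  ext z
  simp

/-- In a facet symmetric about `t / 2`, the reflection of a codimension two face is a face. -/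
theorem codim_two_reflect (hs : P = convexHull ℝ (s : Set _))
    (ht : ∀ x ∈ maxFace P u, t - x ∈ maxFace P u) (hG : IsFaceOfCodim 2 P G)
    (hGu : G ⊆ maxFace P u) : IsFaceOfCodim 2 P ((fun x => t - x) '' G) := by
  refine ⟨hG.1.image _, ?_, by rw [vectorSpan_image_sub_left]; exact hG.2.2⟩
  obtain ⟨f, rfl⟩ := exists_eq_maxFace hG.2.1 hG.1
  obtain ⟨g, hg⟩ := hG.1
  -- Only the facet is symmetric about `t / 2`, not `P`, so the reflected set is first exposed
  -- inside the facet and then in `P` as a face of a face.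
  have e : (fun x => t - x) '' maxFace P f = maxFace (maxFace P u) (-f) := by
    ext y
    simp only [Set.mem_image]
    constructor
    · rintro ⟨x, hx, rfl⟩
      refine ⟨ht x (hGu hx), fun z hz => ?_⟩
      have := hx.2 _ (ht z hz).1
      simp only [inner_neg_left, inner_sub_right] at this ⊢
      linarith
    · rintro ⟨hy, hy'⟩
      refine ⟨t - y, mem_maxFace_of_inner_eq hg (ht y hy).1
        (le_antisymm (hg.2 _ (ht y hy).1) ?_), by simp⟩
      have := hy' _ (ht g (hGu hg))
      simp only [inner_neg_left, inner_sub_right] at this ⊢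
      linarith
  rw [e]
  obtain ⟨v, hv⟩ := maxFace_maxFace (w := -f) hs (by rw [← e]; exact hG.1.image _)
  rw [← hv]
  exact isExposed_maxFace

/-- Passing to the opposite codimension two face of a facet strictly decreases the normal form of
the other facet. -/
theorem inner_reflect_lt (hP : (interior P).Nonempty) (hu : IsPolytopeFacet P (maxFace P u))
    (hv : IsPolytopeFacet P (maxFace P v)) (hne : maxFace P u ≠ maxFace P v)
    (ht : ∀ x ∈ maxFace P u, t - x ∈ maxFace P u) (hx : x ∈ maxFace P u)
    (hx' : x ∈ maxFace P v) : inner ℝ v (t - x) < inner ℝ v x := by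
  refine lt_of_le_of_ne (hx'.2 _ (ht x hx).1) fun h => hne ?_
  refine eq_of_facet_subset hP hu hv fun y hy => mem_maxFace_of_inner_eq hx' hy.1 ?_
  -- If `v` takes its maximum at both `x` and `t - x`, then its values at `y` and `t - y` average to
  -- that maximum without exceeding it, so `y` also attains it.
  have h1 := hx'.2 _ hy.1
  have h2 := hx'.2 _ (ht y hy).1
  simp only [inner_sub_right] at h h2
  linarith

/-- Every facet of a belt contains a codimension two face parallel to the belt. -/
theorem exists_codim_two_subset (hs : P = convexHull ℝ (s : Set _)) (hP : (interior P).Nonempty)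
    (hc : ∀ v, IsPolytopeFacet P (maxFace P v) →
      ∃ t, ∀ x ∈ maxFace P v, t - x ∈ maxFace P v)
    (hG : IsFaceOfCodim 2 P G) (hu : u ∈ (vectorSpan ℝ G)ᗮ) :
    ∃ H, IsFaceOfCodim 2 P H ∧ vectorSpan ℝ H = vectorSpan ℝ G ∧ H ⊆ maxFace P u := by
  classical
  -- Among the vertices on codimension two faces parallel to `G`, take one maximizing `u`; its face
  -- turns out to lie in `maxFace P u`.
  set S := s.filter fun x => ∃ H, IsFaceOfCodim 2 P H ∧ vectorSpan ℝ H = vectorSpan ℝ G ∧ x ∈ H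
  have hmem : ∀ H, IsFaceOfCodim 2 P H → vectorSpan ℝ H = vectorSpan ℝ G → ∃ x ∈ S, x ∈ H := by
    intro H hH hHG
    obtain ⟨f, rfl⟩ := exists_eq_maxFace hH.2.1 hH.1
    obtain ⟨z, hz⟩ := hH.1
    obtain ⟨y, hy, hy'⟩ := exists_mem_maxFace hs hz
    exact ⟨y, Finset.mem_filter.2 ⟨hy, _, hH, hHG, hy'⟩, hy'⟩
  obtain ⟨x₀, hx₀, -⟩ := hmem G hG rfl
  obtain ⟨x, hx, hmax⟩ := S.exists_max_image (fun x => inner ℝ u x) ⟨x₀, hx₀⟩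
  obtain ⟨-, H, hH, hHG, hxH⟩ := Finset.mem_filter.1 hx
  rw [← hHG] at hu
  have hstep : ∀ K, IsFaceOfCodim 2 P K → vectorSpan ℝ K = vectorSpan ℝ G → ∀ y ∈ K,
      inner ℝ u y ≤ inner ℝ u x := by
    intro K hK hKG y hy
    obtain ⟨z, hzS, hz⟩ := hmem K hK hKG
    rw [hHG, ← hKG] at hu
    rw [inner_eq_of_mem_orthogonal hu hy hz]
    exact hmax z hzS
  obtain ⟨a, b, ha, hb, hne, hHa, hHb⟩ := exists_two_facets hs hP hH
  obtain ⟨α, β, hαβ⟩ := exists_combination_of_facets hP hH ha hb hne hHa hHb hu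
  have hin : ∀ z, inner ℝ u z = α * inner ℝ a z + β * inner ℝ b z := by
    intro z
    rw [hαβ]
    simp [inner_add_left, inner_smul_left]
  -- Crossing the facet of `a` to the opposite parallel face fixes `a` and lowers `b`, so a negative
  -- `β` would increase `u` beyond its maximum over such faces.
  have hβ : 0 ≤ β := by
    obtain ⟨t, ht⟩ := hc a ha
    have h1 := inner_reflect_lt hP ha hb hne ht (hHa hxH) (hHb hxH)
    have h2 := hstep _ (codim_two_reflect hs ht hH hHa)
      (by rw [vectorSpan_image_sub_left, hHG]) _ ⟨x, hxH, rfl⟩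
    have h3 := inner_eq_of_mem_maxFace (ht x (hHa hxH)) (hHa hxH)
    rw [hin, hin] at h2
    by_contra! hβ
    simp only at h2
    rw [h3] at h2
    nlinarith
  have hα : 0 ≤ α := by
    obtain ⟨t, ht⟩ := hc b hb
    have h1 := inner_reflect_lt hP hb ha hne.symm ht (hHb hxH) (hHa hxH)
    have h2 := hstep _ (codim_two_reflect hs ht hH hHb)
      (by rw [vectorSpan_image_sub_left, hHG]) _ ⟨x, hxH, rfl⟩
    have h3 := inner_eq_of_mem_maxFace (ht x (hHb hxH)) (hHb hxH)
    rw [hin, hin] at h2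
    by_contra! hα
    simp only at h2
    rw [h3] at h2
    nlinarith
  refine ⟨H, hH, hHG, fun y hy => ⟨(hHa hy).1, fun z hz => ?_⟩⟩
  rw [hin, hin]
  exact add_le_add (mul_le_mul_of_nonneg_left ((hHa hy).2 z hz) hα)
    (mul_le_mul_of_nonneg_left ((hHb hy).2 z hz) hβ)

/-- The facets `A` and `B` meet in a codimension two face with direction `L`. -/
structure BeltAdj (P : Set (EuclideanSpace ℝ (Fin n)))
    (L : Submodule ℝ (EuclideanSpace ℝ (Fin n))) (A B : Set (EuclideanSpace ℝ (Fin n))) :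
    Prop where
  left : IsPolytopeFacet P A
  right : IsPolytopeFacet P B
  ne : A ≠ B
  codim : IsFaceOfCodim 2 P (A ∩ B)
  span : vectorSpan ℝ (A ∩ B) = L

theorem BeltAdj.symm (h : BeltAdj P L A B) : BeltAdj P L B A :=
  ⟨h.right, h.left, h.ne.symm, Set.inter_comm A B ▸ h.codim, Set.inter_comm A B ▸ h.span⟩

theorem neg_maxFace (hc : -P = P) : -maxFace P u = maxFace P (-u) := by
  have hm : ∀ x, -x ∈ P ↔ x ∈ P := fun x => by rw [← Set.mem_neg, hc]
  ext x
  simp only [Set.mem_neg, maxFace, Set.mem_ofPred_eq, hm, inner_neg_left, inner_neg_right]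
  refine and_congr_right fun _ => ⟨fun h y hy => ?_, fun h y hy => ?_⟩
  · have := h (-y) ((hm y).2 hy)
    rw [inner_neg_right] at this
    linarith
  · have := h (-y) ((hm y).2 hy)
    rw [inner_neg_right] at this
    linarith

theorem vectorSpan_neg_set : vectorSpan ℝ (-G) = vectorSpan ℝ G := by
  have := vectorSpan_image_sub_left (t := (0 : EuclideanSpace ℝ (Fin n))) (G := G)
  simpa using this

theorem IsFaceOfCodim.neg {c : ℕ} (hc : -P = P) (h : IsFaceOfCodim c P G) :
    IsFaceOfCodim c P (-G) := by
  refine ⟨h.1.neg, ?_, by rw [vectorSpan_neg_set]; exact h.2.2⟩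
  obtain ⟨u, rfl⟩ := exists_eq_maxFace h.2.1 h.1
  rw [neg_maxFace hc]
  exact isExposed_maxFace

theorem BeltAdj.neg (hc : -P = P) (h : BeltAdj P L A B) : BeltAdj P L (-A) (-B) := by
  refine ⟨h.left.neg hc, h.right.neg hc, fun e => h.ne (neg_injective e), ?_, ?_⟩
  · rw [← Set.inter_neg]
    exact h.codim.neg hc
  · rw [← Set.inter_neg, vectorSpan_neg_set]
    exact h.span

theorem inner_pos_of_facet (hP : (interior P).Nonempty) (hc : -P = P)
    (hu : IsPolytopeFacet P (maxFace P u)) (hx : x ∈ maxFace P u) : 0 < inner ℝ u x := by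
  have hm : ∀ x, -x ∈ P ↔ x ∈ P := fun x => by rw [← Set.mem_neg, hc]
  by_contra! h
  refine ne_zero_of_codim hP one_ne_zero hu (eq_zero_of_inner_const hP ?_)
  have key : ∀ y ∈ P, inner ℝ u y = 0 := by
    intro y hy
    have h1 := hx.2 y hy
    have h2 := hx.2 (-y) ((hm y).2 hy)
    rw [inner_neg_right] at h2
    linarith
  exact fun x hx y hy => (key x hx).trans (key y hy).symm

/-- By central symmetry, a facet normal is positive on its facet, so opposite facets are disjoint.
-/
theorem BeltAdj.ne_neg (hP : (interior P).Nonempty) (hc : -P = P) (h : BeltAdj P L A B) :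
    B ≠ -A := by
  rintro rfl
  obtain ⟨x, hx, hx'⟩ := h.codim.1
  have hA := h.left
  obtain ⟨u, rfl⟩ := exists_eq_maxFace hA.2.1 hA.1
  have h1 := inner_pos_of_facet hP hc hA hx
  rw [Set.mem_neg] at hx'
  have h2 := inner_pos_of_facet hP hc hA hx'
  rw [inner_neg_right] at h2
  linarith

theorem BeltAdj.le_left (h : BeltAdj P L A B) : L ≤ vectorSpan ℝ A :=
  h.span ▸ vectorSpan_mono ℝ Set.inter_subset_left

theorem BeltAdj.le_right (h : BeltAdj P L A B) : L ≤ vectorSpan ℝ B := h.symm.le_left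

/-- A third facet of the belt does not meet the intersection of two adjacent ones. -/
theorem BeltAdj.notMem_third (hP : (interior P).Nonempty) (h : BeltAdj P L A B)
    {C : Set (EuclideanSpace ℝ (Fin n))} (hC : IsPolytopeFacet P C) (hL : L ≤ vectorSpan ℝ C)
    (hA : C ≠ A) (hB : C ≠ B) (hx : x ∈ A) (hx' : x ∈ B) : x ∉ C := by
  intro hxC
  have hA' := h.left
  have hB' := h.right
  obtain ⟨u, rfl⟩ := exists_eq_maxFace hA'.2.1 hA'.1
  obtain ⟨v, rfl⟩ := exists_eq_maxFace hB'.2.1 hB'.1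
  obtain ⟨w, rfl⟩ := exists_eq_maxFace hC.2.1 hC.1
  rw [le_vectorSpan_facet_iff hP hC, ← h.span] at hL
  have hsub : maxFace P u ∩ maxFace P v ⊆ maxFace P w := fun y hy =>
    mem_maxFace_of_inner_eq hxC hy.1.1 (inner_eq_of_mem_orthogonal hL hy ⟨hx, hx'⟩)
  rcases facet_eq_or_eq hP h.codim hA' hB' hC h.ne Set.inter_subset_left Set.inter_subset_right
    hsub with e | e
  · exact hA e
  · exact hB e

theorem exists_beltAdj_of_subset (hs : P = convexHull ℝ (s : Set _))
    (hP : (interior P).Nonempty) (hG : IsFaceOfCodim 2 P G) (hA : IsPolytopeFacet P A)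
    (hGA : G ⊆ A) : ∃ B, BeltAdj P (vectorSpan ℝ G) A B ∧ A ∩ B = G := by
  obtain ⟨u, v, hu, hv, hne, hGu, hGv⟩ := exists_two_facets hs hP hG
  have hi := inter_eq_of_subset hP hG hu hv hne hGu hGv
  have key : BeltAdj P (vectorSpan ℝ G) (maxFace P u) (maxFace P v) :=
    ⟨hu, hv, hne, hi.symm ▸ hG, by rw [hi]⟩
  obtain ⟨w, rfl⟩ := exists_eq_maxFace hA.2.1 hA.1
  rcases facet_eq_or_eq hP hG hu hv hA hne hGu hGv hGA with e | e
  · rw [e]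
    exact ⟨_, key, hi⟩
  · rw [e]
    exact ⟨_, key.symm, by rw [Set.inter_comm, hi]⟩

/-- Every facet of a belt has exactly two neighbours in the belt, and they meet it in opposite
codimension two faces. -/
theorem exists_two_neighbours (hs : P = convexHull ℝ (s : Set _)) (hP : (interior P).Nonempty)
    (hc : ∀ A, IsPolytopeFacet P A → ∃ t, ∀ x ∈ A, t - x ∈ A)
    (hG : IsFaceOfCodim 2 P G) (hA : IsPolytopeFacet P A)
    (hGA : vectorSpan ℝ G ≤ vectorSpan ℝ A) (ht : ∀ x ∈ A, t - x ∈ A) :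
    ∃ B C, B ≠ C ∧ BeltAdj P (vectorSpan ℝ G) A B ∧ BeltAdj P (vectorSpan ℝ G) A C ∧
      (∀ x ∈ A ∩ B, t - x ∈ A ∩ C) ∧ (∀ x ∈ A ∩ C, t - x ∈ A ∩ B) ∧
      ∀ D, BeltAdj P (vectorSpan ℝ G) A D → D = B ∨ D = C := by
  obtain ⟨u, rfl⟩ := exists_eq_maxFace hA.2.1 hA.1
  rw [le_vectorSpan_facet_iff hP hA] at hGA
  obtain ⟨H, hH, hHG, hHu⟩ := exists_codim_two_subset hs hP (fun v => hc _) hG hGA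
  obtain ⟨B, hB, hBi⟩ := exists_beltAdj_of_subset hs hP hH hA hHu
  have hH' := codim_two_reflect hs ht hH hHu
  have hHu' : (fun x => t - x) '' H ⊆ maxFace P u := by
    rintro _ ⟨x, hx, rfl⟩
    exact ht x (hHu hx)
  obtain ⟨C, hC, hCi⟩ := exists_beltAdj_of_subset hs hP hH' hA hHu'
  rw [vectorSpan_image_sub_left] at hC
  rw [hHG] at hB hC
  have hBf := hB.right
  have hCf := hC.right
  obtain ⟨v, rfl⟩ := exists_eq_maxFace hBf.2.1 hBf.1
  obtain ⟨g, hg⟩ := hH.1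
  have hgB : g ∈ maxFace P u ∩ maxFace P v := hBi ▸ hg
  have hgC : t - g ∈ maxFace P u ∩ C := by
    rw [hCi]
    exact ⟨g, hg, rfl⟩
  have hlt := inner_reflect_lt hP hA hBf hB.ne ht hgB.1 hgB.2
  refine ⟨maxFace P v, C, ?_, hB, hC, ?_, ?_, ?_⟩
  · rintro rfl
    exact hlt.ne (inner_eq_of_mem_maxFace hgC.2 hgB.2)
  · intro x hx
    rw [hBi] at hx
    rw [hCi]
    exact ⟨x, hx, rfl⟩
  · intro x hx
    rw [hCi] at hx
    rw [hBi]
    obtain ⟨y, hy, rfl⟩ := hx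
    simpa using hy
  · intro D hD
    have hDf := hD.right
    obtain ⟨w, rfl⟩ := exists_eq_maxFace hDf.2.1 hDf.1
    obtain ⟨d, hd, hd'⟩ := hD.codim.1
    have hw := (le_vectorSpan_facet_iff hP hDf).1 hD.le_right
    rw [← hB.span] at hw
    obtain ⟨a, b, hab⟩ := exists_combination_of_facets hP hB.codim hA hBf hB.ne
      Set.inter_subset_left Set.inter_subset_right hw
    have hin : ∀ z, inner ℝ w z = a * inner ℝ u z + b * inner ℝ v z := by
      intro z
      rw [hab]
      simp [inner_add_left, inner_smul_left]
    have hud := inner_eq_of_mem_maxFace hd hgB.1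
    have hutg := inner_eq_of_mem_maxFace hgC.1 hgB.1
    by_contra! hne
    -- On the facet `maxFace P u` the form `w` is `b • v` up to a constant. The sign of `b` decides
    -- at which end, `g` or `t - g`, it is largest; that end would lie in three facets of the belt.
    rcases le_total 0 b with hb | hb
    · refine hB.notMem_third hP hDf hD.le_right hD.ne.symm hne.1 hgB.1 hgB.2
        (mem_maxFace_of_inner_eq hd' hgB.1.1 (le_antisymm (hd'.2 _ hgB.1.1) ?_))
      rw [hin, hin, hud]
      have := hgB.2.2 d hd.1
      nlinarith
    · refine hC.notMem_third hP hDf hD.le_right hD.ne.symm hne.2 hgC.1 hgC.2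
        (mem_maxFace_of_inner_eq hd' hgC.1.1 (le_antisymm (hd'.2 _ hgC.1.1) ?_))
      rw [hin, hin, hud, hutg]
      have := hgB.2.2 _ (ht d hd).1
      rw [inner_sub_right] at this ⊢
      nlinarith

/-- Three facets of a belt are never pairwise adjacent. -/
theorem not_triangle (hP : (interior P).Nonempty) (hc : -P = P)
    {C : Set (EuclideanSpace ℝ (Fin n))} (hAB : BeltAdj P L A B) (hAC : BeltAdj P L A C)
    (hBC : BeltAdj P L B C) : False := by
  have hA := hAB.left
  have hB := hAB.right
  have hC := hAC.right
  obtain ⟨z, hzB, hzC⟩ := hBC.codim.1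
  obtain ⟨x, hxA, hxB⟩ := hAB.codim.1
  obtain ⟨y, hyA, hyC⟩ := hAC.codim.1
  have hzA := hBC.notMem_third hP hA hAB.le_left hAB.ne hAC.ne hzB hzC
  have hxC := hAB.notMem_third hP hC hAC.le_right hAC.ne.symm hBC.ne.symm hxA hxB
  have hyB := hAC.notMem_third hP hB hAB.le_right hAB.ne.symm hBC.ne hyA hyC
  have hzA' := hBC.notMem_third hP (hA.neg hc) (by rw [vectorSpan_neg_set]; exact hAB.le_left)
    (hAB.ne_neg hP hc).symm (hAC.ne_neg hP hc).symm hzB hzC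
  obtain ⟨u, rfl⟩ := exists_eq_maxFace hA.2.1 hA.1
  obtain ⟨v, rfl⟩ := exists_eq_maxFace hB.2.1 hB.1
  obtain ⟨w, rfl⟩ := exists_eq_maxFace hC.2.1 hC.1
  have hu := (le_vectorSpan_facet_iff hP hA).1 hAB.le_left
  rw [← hBC.span] at hu
  obtain ⟨a, b, hab⟩ := exists_combination_of_facets hP hBC.codim hB hC hBC.ne
    Set.inter_subset_left Set.inter_subset_right hu
  have hin : ∀ z, inner ℝ u z = a * inner ℝ v z + b * inner ℝ w z := by
    intro z
    rw [hab]
    simp [inner_add_left, inner_smul_left]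
  -- Comparing `z` with the points of `A ∩ B` and `A ∩ C` gives `b ≤ 0` and `a ≤ 0`, so `z`
  -- minimizes `u` and lies in `-A`, a third facet through `B ∩ C`.
  have hb : b ≤ 0 := by
    have h1 := inner_lt_of_notMem_maxFace hzC hxA.1 hxC
    have h2 := hxA.2 z hzB.1
    rw [hin, hin, inner_eq_of_mem_maxFace hxB hzB] at h2
    by_contra! h
    nlinarith
  have ha : a ≤ 0 := by
    have h1 := inner_lt_of_notMem_maxFace hzB hyA.1 hyB
    have h2 := hyA.2 z hzB.1
    rw [hin, hin, inner_eq_of_mem_maxFace hyC hzC] at h2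
    by_contra! h
    nlinarith
  apply hzA'
  rw [neg_maxFace hc]
  refine ⟨hzB.1, fun p hp => ?_⟩
  rw [inner_neg_left, inner_neg_left, hin, hin]
  have h1 := mul_le_mul_of_nonpos_left (hzB.2 p hp) ha
  have h2 := mul_le_mul_of_nonpos_left (hzC.2 p hp) hb
  linarith

end Belts

/-! ### Combinatorics of the six-cycle. -/

/-- A symmetric two-regular relation on `±a, ±b, ±c` that is compatible with negation and has
neither triangles nor antipodal edges is a hexagon in which opposite vertices are antipodal. -/
theorem exists_hexagon {α : Type*} [InvolutiveNeg α] {R : α → α → Prop}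
    (hsymm : ∀ x y, R x y → R y x) (hneg : ∀ x y, R x y → R (-x) (-y))
    (hirr : ∀ x y, R x y → x ≠ y) (hanti : ∀ x y, R x y → y ≠ -x)
    (htri : ∀ x y z, R x y → R x z → R y z → False) {a b c : α}
    (hmem : ∀ x y, R x y → y = a ∨ y = -a ∨ y = b ∨ y = -b ∨ y = c ∨ y = -c)
    (htwo : ∀ x, x = a ∨ x = -a ∨ x = b ∨ x = -b ∨ x = c ∨ x = -c →
      ∃ y z, y ≠ z ∧ R x y ∧ R x z ∧ ∀ w, R x w → w = y ∨ w = z)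
    (hns : ∀ x y, R x y → x ≠ -x) (hac : c ≠ a) (hac' : c ≠ -a) (hab : b ≠ a) (hab' : b ≠ -a)
    (hbc : c ≠ b) (hbc' : c ≠ -b) :
    ∃ y z, (y = b ∨ y = -b) ∧ (z = c ∨ z = -c) ∧ R a y ∧ R y z ∧ R z (-a) := by
  have hneg' : ∀ x y, R (-x) y → R x (-y) := fun x y h => by simpa using hneg _ _ h
  have hdeg : ∀ x y z w, R x y → R x z → y ≠ z → R x w → w = y ∨ w = z := by
    intro x y z w hy hz hyz hw
    obtain ⟨y', z', -, -, -, hall⟩ := htwo x (hmem _ _ (hsymm _ _ hy))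
    rcases hall y hy with rfl | rfl <;> rcases hall z hz with rfl | rfl
    · exact absurd rfl hyz
    · exact hall w hw
    · exact (hall w hw).symm
    · exact absurd rfl hyz
  -- If the neighbours of `a` were `±d`, then `±a, ±d` would form a closed 4-cycle, leaving no
  -- possible neighbour for `e`.
  have hsep : ∀ d e : α, (∀ x y, R x y → y = a ∨ y = -a ∨ y = d ∨ y = -d ∨ y = e ∨ y = -e) →
      (∃ w, R e w) → e ≠ a → e ≠ -a → e ≠ d → e ≠ -d → R a d → R a (-d) → False := by
    rintro d e hm ⟨w, hw⟩ h1 h2 h3 h4 had had'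
    have hda : R d a := hsymm _ _ had
    have hda' : R d (-a) := hneg' _ _ (hsymm _ _ had')
    have ha : ∀ w, R a w → w = d ∨ w = -d := fun w => hdeg _ _ _ _ had had' (hns _ _ hda)
    have hd : ∀ w, R d w → w = a ∨ w = -a := fun w => hdeg _ _ _ _ hda hda' (hns _ _ had)
    rcases hm _ _ hw with rfl | rfl | rfl | rfl | rfl | rfl
    · exact (ha _ (hsymm _ _ hw)).elim h3 h4
    · rcases ha _ (hneg' _ _ (hsymm _ _ hw)) with h | h
      · exact h4 (neg_eq_iff_eq_neg.1 h)
      · exact h3 (neg_injective h)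
    · exact (hd _ (hsymm _ _ hw)).elim h1 h2
    · rcases hd _ (hneg' _ _ (hsymm _ _ hw)) with h | h
      · exact h2 (neg_eq_iff_eq_neg.1 h)
      · exact h1 (neg_injective h)
    · exact hirr _ _ hw rfl
    · exact hanti _ _ hw rfl
  have hb : ∃ w, R b w := let ⟨w, _, _, h, _⟩ := htwo b (by simp); ⟨w, h⟩
  have hc : ∃ w, R c w := let ⟨w, _, _, h, _⟩ := htwo c (by simp); ⟨w, h⟩
  have hB : R a b → R a (-b) → False := hsep b c hmem hc hac hac' hbc hbc'
  have hC : R a c → R a (-c) → False := hsep c b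
    (fun x y h => by rcases hmem x y h with h | h | h | h | h | h <;> simp [h])
    hb hab hab' hbc.symm fun h => hbc' (by rw [h, neg_neg])
  -- With `y` and `z` the neighbours of `a`, the other neighbour of `y` can only be `-z`: a further
  -- edge from `y` to `-a` would make `-y` a third neighbour of `a`, and `z` would close a triangle.
  have key : ∀ y z, (y = b ∨ y = -b) → (z = c ∨ z = -c) → R a y → R a z →
      ∃ y z, (y = b ∨ y = -b) ∧ (z = c ∨ z = -c) ∧ R a y ∧ R y z ∧ R z (-a) := by
    intro y z hy hz hay haz
    have hyz : y ≠ z := by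
      rintro rfl
      rcases hy with rfl | rfl <;> rcases hz with h | h
      · exact hbc h.symm
      · exact hbc' (by rw [h, neg_neg])
      · exact hbc' h.symm
      · exact hbc (neg_injective h).symm
    have hyz' : -y ≠ z := by
      rintro rfl
      rcases hy with rfl | rfl <;> rcases hz with h | h
      · exact hbc' h.symm
      · exact hbc (neg_injective h).symm
      · exact hbc (by rw [← h, neg_neg])
      · exact hbc' (neg_injective h).symm
    obtain ⟨w, hwa, hw⟩ : ∃ w, w ≠ a ∧ R y w := by
      obtain ⟨w, w', hne, hw, hw', -⟩ := htwo y (hmem _ _ hay)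
      by_cases h : w = a
      · exact ⟨w', fun h' => hne (h.trans h'.symm), hw'⟩
      · exact ⟨w, h, hw⟩
    have hwy : w ≠ y := (hirr _ _ hw).symm
    have hwy' : w ≠ -y := hanti _ _ hw
    have hwz : w ≠ z := by
      rintro rfl
      exact htri _ _ _ hay haz hw
    have hwa' : w ≠ -a := by
      rintro rfl
      rcases hdeg _ _ _ _ hay haz hyz (hneg' _ _ (hsymm _ _ hw)) with h | h
      · exact hns _ _ hw h.symm
      · exact hyz' h
    have hwz' : w = -z := by
      have hpm : ∀ d x : α, (x = d ∨ x = -d) → (w = d ∨ w = -d) → w = x ∨ w = -x := by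
        rintro d x (rfl | rfl) h
        · exact h
        · rw [neg_neg]
          exact h.symm
      rcases hmem _ _ hw with h | h | h | h | h | h
      · exact absurd h hwa
      · exact absurd h hwa'
      · exact ((hpm b y hy (Or.inl h)).elim hwy hwy').elim
      · exact ((hpm b y hy (Or.inr h)).elim hwy hwy').elim
      · exact (hpm c z hz (Or.inl h)).resolve_left hwz
      · exact (hpm c z hz (Or.inr h)).resolve_left hwz
    subst hwz'
    exact ⟨y, -z, hy, by rcases hz with rfl | rfl <;> simp, hay, hw, hneg _ _ (hsymm _ _ haz)⟩
  obtain ⟨y, z, hyz, hy, hz, -⟩ := htwo a (Or.inl rfl)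
  rcases hmem _ _ hy with rfl | rfl | rfl | rfl | rfl | rfl
  · exact absurd rfl (hirr _ _ hy)
  · exact absurd rfl (hanti _ _ hy)
  all_goals
    rcases hmem _ _ hz with rfl | rfl | rfl | rfl | rfl | rfl
    · exact absurd rfl (hirr _ _ hz)
    · exact absurd rfl (hanti _ _ hz)
    all_goals first
      | exact absurd rfl hyz
      | exact (hB hy hz).elim
      | exact (hB hz hy).elim
      | exact (hC hy hz).elim
      | exact (hC hz hy).elim
      | (refine key _ _ ?_ ?_ hy hz <;> first | exact Or.inl rfl | exact Or.inr rfl)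
      | (refine key _ _ ?_ ?_ hz hy <;> first | exact Or.inl rfl | exact Or.inr rfl)

/-! ### Metric relations in 2-belts and 3-belts. -/

section Final

variable {n : ℕ} {P A B G : Set (EuclideanSpace ℝ (Fin n))}
  {s : Finset (EuclideanSpace ℝ (Fin n))} {u v w x y t : EuclideanSpace ℝ (Fin n)}
  {L : Submodule ℝ (EuclideanSpace ℝ (Fin n))}

/-- Iterating a nonzero translation would leave the bounded set. -/
theorem eq_zero_of_add_mem {K : Set (EuclideanSpace ℝ (Fin n))} (hK : Bornology.IsBounded K)
    (hx : x ∈ K) (h : ∀ y ∈ K, y + u ∈ K) : u = 0 := by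
  obtain ⟨R, hR⟩ := hK.exists_norm_le
  have hm : ∀ m : ℕ, x + (m : ℝ) • u ∈ K := by
    intro m
    induction m with
    | zero => simpa using hx
    | succ m ih =>
      have := h _ ih
      rwa [add_assoc, show (m : ℝ) • u + u = ((m + 1 : ℕ) : ℝ) • u by push_cast; module] at this
  by_contra hu
  obtain ⟨m, hm'⟩ := exists_nat_gt ((R + ‖x‖) / ‖u‖)
  rw [div_lt_iff₀ (norm_pos_iff.2 hu)] at hm'
  have h1 := hR _ (hm m)
  have h2 : ‖(m : ℝ) • u‖ ≤ ‖x + (m : ℝ) • u‖ + ‖x‖ := by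
    simpa using norm_sub_le (x + (m : ℝ) • u) x
  rw [norm_smul, Real.norm_natCast] at h2
  linarith

theorem IsPolytopeFacet.ne_neg (hP : (interior P).Nonempty) (hc : -P = P)
    (hA : IsPolytopeFacet P A) : A ≠ -A := by
  intro h
  obtain ⟨u, rfl⟩ := exists_eq_maxFace hA.2.1 hA.1
  obtain ⟨x, hx⟩ := hA.1
  have h1 := inner_pos_of_facet hP hc hA hx
  rw [h, Set.mem_neg] at hx
  have h2 := inner_pos_of_facet hP hc hA hx
  rw [inner_neg_right] at h2
  linarith

theorem BeltAdj.reflect (hs : P = convexHull ℝ (s : Set _)) (hP : (interior P).Nonempty)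
    (hc : ∀ A, IsPolytopeFacet P A → ∃ t, ∀ x ∈ A, t - x ∈ A)
    {C : Set (EuclideanSpace ℝ (Fin n))} (hB : BeltAdj P L A B) (hC : BeltAdj P L A C)
    (hBC : B ≠ C) (ht : ∀ x ∈ A, t - x ∈ A) (hx : x ∈ A) (hx' : x ∈ B) : t - x ∈ C := by
  obtain rfl := hB.span
  obtain ⟨D, E, -, -, -, hDE, hED, hall⟩ :=
    exists_two_neighbours hs hP hc hB.codim hB.left hB.le_left ht
  rcases hall B hB with rfl | rfl <;> rcases hall C hC with rfl | rfl
  · exact absurd rfl hBC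
  · exact (hDE x ⟨hx, hx'⟩).2
  · exact (hED x ⟨hx, hx'⟩).2
  · exact absurd rfl hBC

/-- The vertices `x`, `y`, `z` of the hexagon of a 3-belt, and the resulting relations between
lattice vectors and normals. -/
theorem hexagon_relations (hs : P = convexHull ℝ (s : Set _)) (hP : (interior P).Nonempty)
    (hcen : -P = P) (hc : ∀ A, IsPolytopeFacet P A → ∃ t, ∀ x ∈ A, t - x ∈ A)
    {t₁ t₂ t₃ : EuclideanSpace ℝ (Fin n)}
    (huv : BeltAdj P L (maxFace P u) (maxFace P v)) (hvw : BeltAdj P L (maxFace P v) (maxFace P w))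
    (hwu : BeltAdj P L (maxFace P w) (-maxFace P u))
    (ht₁ : ∀ x ∈ maxFace P u, t₁ - x ∈ maxFace P u)
    (ht₂ : ∀ x ∈ maxFace P v, t₂ - x ∈ maxFace P v)
    (ht₃ : ∀ x ∈ maxFace P w, t₃ - x ∈ maxFace P w) :
    (∃ b c : ℝ, 0 < b ∧ 0 < c ∧ u = b • v - c • w) ∧
    ∃ x y z, t₁ = x + y ∧ t₂ = x + z ∧ -t₃ = y - z ∧ inner ℝ u x = inner ℝ u y ∧
      inner ℝ v x = inner ℝ v z ∧ inner ℝ w (y + z) = 0 := by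
  have hu := huv.left
  have hv := huv.right
  have hw := hvw.right
  have huw : BeltAdj P L (maxFace P u) (-maxFace P w) := by
    simpa using (hwu.neg hcen).symm
  have hvu' : maxFace P v ≠ -maxFace P u := huv.ne_neg hP hcen
  have hwv' : maxFace P w ≠ -maxFace P v := hvw.ne_neg hP hcen
  have hvw' : maxFace P v ≠ -maxFace P w := fun h => hwv' (by rw [h, neg_neg])
  have hwu' : maxFace P w ≠ maxFace P u := fun h => hwu.ne_neg hP hcen (by rw [h])
  obtain ⟨x, hxu, hxv⟩ := huv.codim.1
  have step : ∀ x ∈ maxFace P u ∩ maxFace P v,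
      t₁ - x ∈ maxFace P u ∩ -maxFace P w ∧ t₂ - x ∈ maxFace P v ∩ maxFace P w :=
    fun x hx => ⟨⟨ht₁ x hx.1, huv.reflect hs hP hc huw hvw' ht₁ hx.1 hx.2⟩,
      ⟨ht₂ x hx.2, huv.symm.reflect hs hP hc hvw hwu'.symm ht₂ hx.2 hx.1⟩⟩
  obtain ⟨⟨hyu, hyw⟩, hzv, hzw⟩ := step x ⟨hxu, hxv⟩
  -- Going round by reflections in `B`, `C` and `A`, with one central inversion, maps `A ∩ B` into
  -- itself by translation through `t₁ + t₃ - t₂`.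
  have hd : t₁ + t₃ - t₂ = 0 := by
    refine eq_zero_of_add_mem (K := maxFace P u ∩ maxFace P v) ?_ ⟨hxu, hxv⟩ fun p hp => ?_
    · refine Bornology.IsBounded.subset ?_ (Set.inter_subset_left.trans fun _ h => h.1)
      rw [hs]
      exact (isBounded_convexHull).2 s.finite_toSet.isBounded
    · obtain ⟨-, h2, h3⟩ := step p hp
      have h4 := hvw.symm.reflect hs hP hc hwu hvu' ht₃ h3 h2
      have h5 := ht₃ _ h3
      have h6 := huw.reflect hs hP hc huv hvw'.symm ht₁ (x := -(t₃ - (t₂ - p))) h4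
        (by simpa using h5)
      have h7 := ht₁ _ h4
      have e : t₁ - -(t₃ - (t₂ - p)) = p + (t₁ + t₃ - t₂) := by abel
      rw [e] at h6 h7
      exact ⟨h7, h6⟩
  rw [Set.mem_neg] at hyw
  refine ⟨?_, x, t₁ - x, t₂ - x, by abel, by abel, ?_, inner_eq_of_mem_maxFace hxu hyu,
    inner_eq_of_mem_maxFace hxv hzv, ?_⟩
  · have huL := (le_vectorSpan_facet_iff hP hu).1 huv.le_left
    rw [← hvw.span] at huL
    obtain ⟨b, c, hbc⟩ := exists_combination_of_facets hP hvw.codim hv hw hvw.ne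
      Set.inter_subset_left Set.inter_subset_right huL
    have hin : ∀ z, inner ℝ u z = b * inner ℝ v z + c * inner ℝ w z := by
      intro z
      rw [hbc]
      simp [inner_add_left, inner_smul_left]
    have hzu := hvw.notMem_third hP hu huv.le_left huv.ne hwu'.symm hzv hzw
    have hzu' := hvw.notMem_third hP (hu.neg hcen) hwu.le_right hvu'.symm hwu.ne.symm hzv hzw
    have hxw := huv.notMem_third hP hw hvw.le_right hwu' hvw.ne.symm hxu hxv
    have hyv := hwu.notMem_third hP hv huv.le_right hvw.ne hvu' hyw (by simpa using hyu)
    refine ⟨b, -c, ?_, ?_, by rw [hbc]; simp⟩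
    -- Along `C` the form `w` is constant, so comparing `-y` with `z` isolates the sign of `b`;
    -- along `B` the pair `x`, `z` isolates that of `c`.
    · have h1 := inner_lt_of_notMem_maxFace hzv hyw.1 hyv
      have h2 := inner_eq_of_mem_maxFace hyw hzw
      have h3 : -(t₁ - x) ∈ maxFace P (-u) := by
        rw [← neg_maxFace hcen]
        simpa using hyu
      rw [neg_maxFace hcen] at hzu'
      have h4 := inner_lt_of_notMem_maxFace h3 hzv.1 hzu'
      rw [inner_neg_left, inner_neg_left, hin, hin, h2] at h4
      by_contra! hb
      nlinarith
    · have h1 := inner_lt_of_notMem_maxFace hzw hxu.1 hxw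
      have h2 := inner_eq_of_mem_maxFace hxv hzv
      have h4 := inner_lt_of_notMem_maxFace hxu hzv.1 hzu
      rw [hin, hin, h2] at h4
      by_contra! hc'
      nlinarith
  · rw [eq_comm, ← sub_eq_zero, ← hd]
    abel
  · have := inner_eq_of_mem_maxFace hyw hzw
    rw [inner_neg_right] at this
    rw [inner_add_right]
    linarith

theorem pair_independent_of_ne_neg (hP : (interior P).Nonempty) (hcen : -P = P)
    (hu : IsPolytopeFacet P (maxFace P u)) (hv : IsPolytopeFacet P (maxFace P v))
    (hne : maxFace P u ≠ maxFace P v) (hne' : maxFace P u ≠ -maxFace P v) :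
    LinearIndependent ℝ ![u, v] := by
  rw [LinearIndependent.pair_iff' (ne_zero_of_codim hP one_ne_zero hu)]
  intro a ha
  rcases lt_trichotomy a 0 with h | h | h
  · apply hne'
    rw [neg_maxFace hcen, ← ha, ← neg_smul, maxFace_smul (neg_pos.2 h)]
  · subst h
    exact ne_zero_of_codim hP one_ne_zero hv (by simpa using ha.symm)
  · apply hne
    rw [← ha, maxFace_smul h]

variable {ι : Type*} {T : AddSubgroup (EuclideanSpace ℝ (Fin n))}
  {F : ι → Set (EuclideanSpace ℝ (Fin n))} {τ q : ι → EuclideanSpace ℝ (Fin n)} {i j k : ι}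

/-- The point reflection about `τ j / 2` exchanges `P` and `τ j + P`, hence preserves their
intersection. -/
theorem IsFacetSystem.reflect (hF : IsFacetSystem P T F τ) (hcen : -P = P) (j : ι)
    (hx : x ∈ F j) : τ j - x ∈ F j := by
  have hm : ∀ x, -x ∈ P ↔ x ∈ P := fun x => by rw [← Set.mem_neg, hcen]
  rw [← hF.adjacent j, Set.mem_inter_iff, Set.mem_vadd_set_iff_neg_vadd_mem, vadd_eq_add] at hx ⊢
  rw [← hm, ← hm (-τ j + _)]
  refine ⟨?_, ?_⟩
  · convert hx.2 using 1
    abel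
  · convert hx.1 using 1
    abel

theorem IsFacetSystem.exists_center (hF : IsFacetSystem P T F τ) (hcen : -P = P)
    (hA : IsPolytopeFacet P A) : ∃ t, ∀ x ∈ A, t - x ∈ A := by
  obtain ⟨j, rfl | rfl, -⟩ := hF.enumerates A hA
  · exact ⟨τ j, fun x hx => hF.reflect hcen j hx⟩
  · refine ⟨-τ j, fun x hx => ?_⟩
    rw [Set.mem_neg] at hx ⊢
    convert hF.reflect hcen j hx using 1
    abel

theorem IsFacetSystem.facet_ne (hF : IsFacetSystem P T F τ) (h : j ≠ k) :
    F j ≠ F k ∧ F j ≠ -F k := by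
  obtain ⟨l, -, hl⟩ := hF.enumerates (F j) (hF.facet j)
  have h1 := hl j (Or.inl rfl)
  exact ⟨fun e => h (h1.trans (hl k (Or.inl e)).symm), fun e => h (h1.trans (hl k (Or.inr e)).symm)⟩

theorem IsFacetSystem.translation_ne_zero (hF : IsFacetSystem P T F τ)
    (hP : (interior P).Nonempty) (j : ι) : τ j ≠ 0 := by
  intro h
  have h1 := hF.adjacent j
  rw [h, zero_vadd, Set.inter_self] at h1
  have h2 := (hF.facet j).2.2
  rw [← h1, vectorSpan_eq_top_of_interior hP, finrank_top, finrank_euclideanSpace_fin] at h2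
  omega

/-- Signed facets `±F j` have normals `±q j` and centres of symmetry `±τ j / 2`. -/
theorem exists_sign (hF : IsFacetSystem P T F τ) (hcen : -P = P)
    (hq : ∀ j, IsFacetVector P (F j) (q j)) (hA : A = F j ∨ A = -F j) :
    ∃ ε : ℝ, (ε = 1 ∨ ε = -1) ∧ A = maxFace P (ε • q j) ∧ ∀ x ∈ A, ε • τ j - x ∈ A := by
  have hq' : F j = maxFace P (q j) := hq j
  rcases hA with rfl | rfl
  · exact ⟨1, Or.inl rfl, by simpa using hq', fun x hx => by simpa using hF.reflect hcen j hx⟩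
  · refine ⟨-1, Or.inr rfl, by rw [neg_one_smul, ← neg_maxFace hcen, hq'], fun x hx => ?_⟩
    rw [Set.mem_neg] at hx ⊢
    convert hF.reflect hcen j hx using 1
    rw [neg_one_smul]
    abel

theorem inner_eq_zero_of_twoBelt (hs : P = convexHull ℝ (s : Set _)) (hP : (interior P).Nonempty)
    (hcen : -P = P) (hF : IsFacetSystem P T F τ) (hq : ∀ j, IsFacetVector P (F j) (q j))
    (h : IsTwoBelt P F i j) : inner ℝ (q j) (τ i) = 0 := by
  obtain ⟨-, G, hG, hbelt⟩ := h
  have hiG : F i ∈ facetBelt P G := by simp [hbelt]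
  obtain ⟨B, C, hBC, hB, hC, hrefl, -, -⟩ := exists_two_neighbours hs hP
    (fun A hA => hF.exists_center hcen hA) hG hiG.1 hiG.2 (fun x hx => hF.reflect hcen i hx)
  have hmem : ∀ D, BeltAdj P (vectorSpan ℝ G) (F i) D → D = F j ∨ D = -F j := by
    intro D hD
    have : D ∈ facetBelt P G := ⟨hD.right, hD.le_right⟩
    rw [hbelt] at this
    rcases this with e | e | e
    · exact absurd e hD.ne.symm
    · exact absurd e (hD.ne_neg hP hcen)
    · exact e
  have hCB : C = -B := by
    rcases hmem B hB with rfl | rfl <;> rcases hmem C hC with rfl | rfl <;> simp_all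
  subst hCB
  obtain ⟨ε, hε, rfl, -⟩ := exists_sign hF hcen hq (hmem B hB)
  -- Both `x` and `x - τ i` lie in `B`, so the normal of `B` vanishes on `τ i`.
  obtain ⟨x, hx⟩ := hB.codim.1
  have h1 := (hrefl x hx).2
  rw [Set.mem_neg] at h1
  have h2 := inner_eq_of_mem_maxFace h1 hx.2
  rw [inner_neg_right, inner_sub_right] at h2
  have h3 : inner ℝ (ε • q j) (τ i) = 0 := by linarith
  rw [inner_smul_left] at h3
  rcases hε with rfl | rfl <;> simpa using h3

theorem IsThreeBelt.swap (h : IsThreeBelt P F i j k) : IsThreeBelt P F i k j := by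
  obtain ⟨hij, hik, hjk, G, hG, hb⟩ := h
  refine ⟨hik, hij, hjk.symm, G, hG, hb.trans ?_⟩
  ext
  simp only [Set.mem_insert_iff, Set.mem_singleton_iff]
  tauto

theorem threeBelt_relations (hs : P = convexHull ℝ (s : Set _)) (hP : (interior P).Nonempty)
    (hcen : -P = P) (hF : IsFacetSystem P T F τ) (hq : ∀ j, IsFacetVector P (F j) (q j))
    (h : IsThreeBelt P F i j k) :
    j ∈ adjacentIndices P F i ∧
    ∃ ε δ : ℝ, (ε = 1 ∨ ε = -1) ∧ (δ = 1 ∨ δ = -1) ∧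
      (∃ b c : ℝ, 0 < b ∧ 0 < c ∧ q i = (ε * b) • q j + (δ * c) • q k) ∧
      ∃ x y z, τ i = x + y ∧ ε • τ j = x + z ∧ δ • τ k = y - z ∧
        inner ℝ (q i) x = inner ℝ (q i) y ∧ inner ℝ (q j) x = inner ℝ (q j) z ∧
        inner ℝ (q k) (y + z) = 0 := by
  obtain ⟨hij, hik, hjk, G, hG, hbelt⟩ := h
  have hcent : ∀ A, IsPolytopeFacet P A → ∃ t, ∀ x ∈ A, t - x ∈ A :=
    fun A hA => hF.exists_center hcen hA
  have hmem : ∀ A, A ∈ facetBelt P G ↔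
      A = F i ∨ A = -F i ∨ A = F j ∨ A = -F j ∨ A = F k ∨ A = -F k := by
    intro A
    rw [hbelt]
    simp
  obtain ⟨B, C, hB, hC, hiB, hBC, hCi⟩ := exists_hexagon (R := BeltAdj P (vectorSpan ℝ G))
    (a := F i) (b := F j) (c := F k)
    (fun _ _ h => h.symm) (fun _ _ h => h.neg hcen) (fun _ _ h => h.ne)
    (fun _ _ h => h.ne_neg hP hcen) (fun _ _ _ h₁ h₂ h₃ => not_triangle hP hcen h₁ h₂ h₃)
    (fun _ y h => (hmem y).1 ⟨h.right, h.le_right⟩)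
    (fun x hx => by
      obtain ⟨hx1, hx2⟩ := (hmem x).2 hx
      obtain ⟨t, ht⟩ := hcent x hx1
      obtain ⟨B, C, h1, h2, h3, -, -, h4⟩ := exists_two_neighbours hs hP hcent hG hx1 hx2 ht
      exact ⟨B, C, h1, h2, h3, h4⟩)
    (fun _ _ h => h.left.ne_neg hP hcen)
    (hF.facet_ne hik.symm).1 (hF.facet_ne hik.symm).2 (hF.facet_ne hij.symm).1
    (hF.facet_ne hij.symm).2 (hF.facet_ne hjk.symm).1 (hF.facet_ne hjk.symm).2
  refine ⟨?_, ?_⟩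
  · rcases hB with rfl | rfl
    · exact Or.inl hiB.codim
    · exact Or.inr hiB.codim
  have hqi : F i = maxFace P (q i) := hq i
  obtain ⟨ε, hε, rfl, htB⟩ := exists_sign hF hcen hq hB
  obtain ⟨δ, hδ, rfl, htC⟩ := exists_sign hF hcen hq hC
  have hti : ∀ x ∈ F i, τ i - x ∈ F i := fun x hx => hF.reflect hcen i hx
  rw [hqi] at hiB hCi hti
  obtain ⟨⟨b, c, hb, hc, hbc⟩, x, y, z, h1, h2, h3, h4, h5, h6⟩ :=
    hexagon_relations hs hP hcen hcent hiB hBC hCi hti htB htC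
  -- The sign of `k` flips because the second neighbour of `F i` is `-C`, not `C`.
  refine ⟨ε, -δ, hε, by rcases hδ with rfl | rfl <;> simp, ⟨b, c, hb, hc, ?_⟩, x, y, z, h1, h2,
    by rw [neg_smul, h3], h4, ?_, ?_⟩
  · rw [hbc, smul_smul, smul_smul, mul_comm b, mul_comm c, neg_mul, neg_smul, sub_eq_add_neg]
  · rw [inner_smul_left, inner_smul_left] at h5
    rcases hε with rfl | rfl <;> simpa using h5
  · rw [inner_smul_left] at h6
    rcases hδ with rfl | rfl <;> simpa using h6

/-- `q i` and `q j` already span the plane of normals of the belt, so every facet of one belt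
through them belongs to the other. -/
theorem threeBelt_unique (hP : (interior P).Nonempty)
    (hcen : -P = P) (hF : IsFacetSystem P T F τ) (hq : ∀ j, IsFacetVector P (F j) (q j)) {k' : ι}
    (h : IsThreeBelt P F i j k) (h' : IsThreeBelt P F i j k') : k = k' := by
  obtain ⟨hij, hik, hjk, G, hG, hb⟩ := h
  obtain ⟨-, -, -, G', hG', hb'⟩ := h'
  have hqq : ∀ l, F l = maxFace P (q l) := hq
  have hmem : ∀ G l, F l ∈ facetBelt P G ↔ q l ∈ (vectorSpan ℝ G)ᗮ := by
    intro G l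
    have hl := hF.facet l
    rw [hqq l] at hl
    rw [← le_vectorSpan_facet_iff hP hl, hqq l]
    exact ⟨fun h => h.2, fun h => ⟨hl, h⟩⟩
  have hi := (hmem G i).1 (by simp [hb])
  have hj := (hmem G j).1 (by simp [hb])
  have hk := (hmem G k).1 (by simp [hb])
  have hi' := (hmem G' i).1 (by simp [hb'])
  have hj' := (hmem G' j).1 (by simp [hb'])
  have hli : LinearIndependent ℝ ![q i, q j] :=
    pair_independent_of_ne_neg hP hcen (hqq i ▸ hF.facet i) (hqq j ▸ hF.facet j)
      (by rw [← hqq, ← hqq]; exact (hF.facet_ne hij).1)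
      (by rw [← hqq, ← hqq]; exact (hF.facet_ne hij).2)
  obtain ⟨a, b, hab⟩ := exists_pair_combination (finrank_orthogonal_of_codim hG) hli hi hj hk
  have hk' : F k ∈ facetBelt P G' := by
    rw [hmem, hab]
    exact Submodule.add_mem _ (Submodule.smul_mem _ _ hi') (Submodule.smul_mem _ _ hj')
  rw [hb'] at hk'
  by_contra hne
  have h1 := hF.facet_ne hik.symm
  have h2 := hF.facet_ne hjk.symm
  have h3 := hF.facet_ne hne
  simp only [Set.mem_insert_iff, Set.mem_singleton_iff] at hk'
  tauto

theorem coeff_unique (hP : (interior P).Nonempty)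
    (hcen : -P = P) (hF : IsFacetSystem P T F τ) (hq : ∀ j, IsFacetVector P (F j) (q j))
    (hjk : j ≠ k) {a b a' b' : ℝ}
    (h : a • q j + b • q k = a' • q j + b' • q k) : a = a' := by
  have hqq : ∀ l, F l = maxFace P (q l) := hq
  have hli : LinearIndependent ℝ ![q j, q k] :=
    pair_independent_of_ne_neg hP hcen (hqq j ▸ hF.facet j) (hqq k ▸ hF.facet k)
      (by rw [← hqq, ← hqq]; exact (hF.facet_ne hjk).1)
      (by rw [← hqq, ← hqq]; exact (hF.facet_ne hjk).2)
  have := (LinearIndependent.pair_iff.1 hli (a - a') (b - b') (by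
    rw [sub_smul, sub_smul, sub_add_sub_comm, h, sub_self])).1
  linarith

end Final

/-! ### The scaling and the symmetry relations. -/

theorem mainTheorem6 {n : ℕ} {ι : Type*} (P : Set (EuclideanSpace ℝ (Fin n)))
    (T : AddSubgroup (EuclideanSpace ℝ (Fin n))) (hP : IsParallelotope P T)
    (hcenter : -P = P)
    (F : ι → Set (EuclideanSpace ℝ (Fin n))) (t q : ι → EuclideanSpace ℝ (Fin n))
    (hF : IsFacetSystem P T F t) (hq : ∀ j, IsFacetVector P (F j) (q j)) (i : ι) :
    (∃ β : ι → ℝ, (∀ j, 0 < β j) ∧ (∀ j, j ∉ adjacentIndices P F i → β j = 1) ∧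
      IsCanonicalAt P F t (fun j => β j • q j) i) ∧
    (∀ p : ι → EuclideanSpace ℝ (Fin n),
      (∀ j, ∃ β : ℝ, β ≠ 0 ∧ p j = β • q j) → IsCanonicalAt P F t p i →
      (∀ j k, IsThreeBelt P F i j k →
        inner ℝ (p i) (t j) = inner ℝ (p j) (t i) ∧
        inner ℝ (p i) (t k) = inner ℝ (p k) (t i) ∧
        inner ℝ (p j) (t k) = inner ℝ (p k) (t j)) ∧
      (∀ j, IsTwoBelt P F i j →
        inner ℝ (p j) (t i) = 0 ∧ inner ℝ (p i) (t j) = 0)) := by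
  classical
  obtain ⟨s, hs⟩ := hP.polytope
  have hint := hP.interior_nonempty
  refine ⟨?_, fun p hp hcan => ⟨fun j k h => ?_, fun j h => ?_⟩⟩
  -- `R j b` says that `b` is the positive size of the coefficient of `q j` in some 3-belt through
  -- `i`. It is single-valued, so it defines the scaling, with default `1` where no such belt
  -- exists, in particular at `i` itself.
  · let R : ι → ℝ → Prop := fun j b => ∃ (k : ι) (c ε δ : ℝ), 0 < b ∧ (ε = 1 ∨ ε = -1) ∧
      IsThreeBelt P F i j k ∧ q i = (ε * b) • q j + (δ * c) • q k
    have huniq : ∀ j b b', R j b → R j b' → b = b' := by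
      rintro j b b' ⟨k, c, ε, δ, hb, hε, h, e⟩ ⟨k', c', ε', δ', hb', hε', h', e'⟩
      obtain rfl := threeBelt_unique hint hcenter hF hq h h'
      have := coeff_unique hint hcenter hF hq h.2.2.1 (e.symm.trans e')
      rcases hε with rfl | rfl <;> rcases hε' with rfl | rfl <;> linarith
    let β : ι → ℝ := fun j => if h : ∃ b, R j b then h.choose else 1
    have hβ : ∀ j b, R j b → β j = b := by
      intro j b h
      have hex : ∃ b, R j b := ⟨b, h⟩
      simp only [β, dif_pos hex]
      exact huniq _ _ _ hex.choose_spec h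
    have hβ' : ∀ j, (¬ ∃ b, R j b) → β j = 1 := fun j h => by simp only [β, dif_neg h]
    refine ⟨β, fun j => ?_, fun j hj => hβ' j ?_, fun j k h => ?_⟩
    · by_cases h : ∃ b, R j b
      · obtain ⟨b, hb⟩ := h
        rw [hβ j b hb]
        obtain ⟨k, c, ε, δ, hpos, -⟩ := hb
        exact hpos
      · rw [hβ' j h]
        exact one_pos
    · rintro ⟨b, k, c, ε, δ, -, -, h, -⟩
      exact hj (threeBelt_relations hs hint hcenter hF hq h).1
    · obtain ⟨-, ε, δ, hε, hδ, ⟨b, c, hb, hc, e⟩, x, y, z, h1, h2, h3, -⟩ :=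
        threeBelt_relations hs hint hcenter hF hq h
      refine ⟨ε, δ, hε, hδ, by rw [h1, h2, h3]; abel, ?_⟩
      have hi : β i = 1 := hβ' i (by
        rintro ⟨b, k, c, ε, δ, -, -, h, -⟩
        exact h.1 rfl)
      have hj : β j = b := hβ j b ⟨k, c, ε, δ, hb, hε, h, e⟩
      have hk : β k = c := hβ k c ⟨j, b, δ, ε, hc, hδ, h.swap, by rw [e, add_comm]⟩
      simp only [hi, hj, hk, one_smul, smul_smul]
      exact e
  · obtain ⟨-, ε, δ, hε, hδ, -, x, y, z, h1, h2, h3, h4, h5, h6⟩ :=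
      threeBelt_relations hs hint hcenter hF hq h
    obtain ⟨ε', δ', hε', hδ', ht, hpe⟩ := hcan j k h
    have htr : t i = ε • t j + δ • t k := by
      rw [h1, h2, h3]
      abel
    have hti := hF.translation_ne_zero hint i
    have htj := hF.translation_ne_zero hint j
    have htk := hF.translation_ne_zero hint k
    have hopp : ∀ a b : ℝ, (a = 1 ∨ a = -1) → (b = 1 ∨ b = -1) → a ≠ b → a = -b := by
      rintro a b (rfl | rfl) (rfl | rfl) h <;> simp_all
    have hself : ∀ v : EuclideanSpace ℝ (Fin n), v = -v → v = 0 := fun v hv => by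
      have : (2 : ℝ) • v = 0 := by rw [two_smul, ← sub_neg_eq_add, ← hv, sub_self]
      simpa using this
    have hsmul : ∀ (a : ℝ) (v : EuclideanSpace ℝ (Fin n)), (a = 1 ∨ a = -1) → a • v = -(a • v) →
        v = 0 := by
      rintro a v (rfl | rfl) h <;> simpa using hself _ h
    -- Two different sign patterns for `t i` would force one of `t i`, `t j`, `t k` to vanish.
    have hsign : ε' = ε ∧ δ' = δ := by
      by_contra hne
      by_cases e : ε' = ε
      · obtain rfl := hopp δ' δ hδ' hδ fun e' => hne ⟨e, e'⟩
        rw [htr, e, neg_smul] at ht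
        exact htk (hsmul δ _ hδ (add_left_cancel ht))
      · obtain rfl := hopp ε' ε hε' hε e
        by_cases e' : δ' = δ
        · rw [htr, e', neg_smul] at ht
          exact htj (hsmul ε _ hε (add_right_cancel ht))
        · obtain rfl := hopp δ' δ hδ' hδ e'
          rw [neg_smul, neg_smul, ← neg_add, ← htr] at ht
          exact hti (hself _ ht)
    obtain ⟨rfl, rfl⟩ := hsign
    obtain ⟨βi, -, hpi⟩ := hp i
    obtain ⟨βj, -, hpj⟩ := hp j
    obtain ⟨βk, -, hpk⟩ := hp k
    have g4 : inner ℝ (p i) x = inner ℝ (p i) y := by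
      rw [hpi, inner_smul_left, inner_smul_left, h4]
    have g5 : inner ℝ (p j) x = inner ℝ (p j) z := by
      rw [hpj, inner_smul_left, inner_smul_left, h5]
    have g6 : inner ℝ (p k) y + inner ℝ (p k) z = 0 := by
      rw [← inner_add_right, hpk, inner_smul_left, h6, mul_zero]
    have hinv : ∀ (a : ℝ) (v w : EuclideanSpace ℝ (Fin n)), (a = 1 ∨ a = -1) → a • v = w →
        v = a • w := by
      rintro a v w (rfl | rfl) rfl <;> simp
    rw [hpe] at g4
    -- Once everything is written in `x`, `y`, `z`, the claims are linear consequences of the three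
    -- constancy relations `g4`, `g5`, `g6`.
    rw [h1, hinv _ _ _ hε' h2, hinv _ _ _ hδ' h3, hpe]
    simp only [inner_add_left, inner_add_right, inner_sub_right, inner_smul_left, inner_smul_right,
      conj_trivial] at g4 ⊢
    rcases hε' with rfl | rfl <;> rcases hδ' with rfl | rfl <;>
      refine ⟨?_, ?_, ?_⟩ <;> linarith
  · obtain ⟨βi, -, hpi⟩ := hp i
    obtain ⟨βj, -, hpj⟩ := hp j
    have h' : IsTwoBelt P F j i := by
      obtain ⟨hij, G, hG, hb⟩ := h
      refine ⟨hij.symm, G, hG, hb.trans ?_⟩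
      ext
      simp only [Set.mem_insert_iff, Set.mem_singleton_iff]
      tauto
    rw [hpi, hpj, inner_smul_left, inner_smul_left,
      inner_eq_zero_of_twoBelt hs hint hcenter hF hq h,
      inner_eq_zero_of_twoBelt hs hint hcenter hF hq h']
    simp
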